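/- Let $T$ be a nondegenerate tetrahedron with vertices $v_1,v_2,v_3,v_4$ in one of the three geometries $\mathbf S^3$, $\mathbf H^3$, $\mathbf E^3$ (of constant curvature $1$, $-1$, $0$). For $i\neq j$ let $x_{ij}=x_{ji}$ be the length of the edge $v_iv_j$ and $a_{ij}=a_{ji}$ the dihedral angle at that edge. The dihedral angles of tetrahedra in the given geometry are functions of the six edge lengths $(x_{12},x_{13},x_{14},x_{23},x_{24},x_{34})$, defined and differentiable on a neighbourhood in $\mathbb R^6$ of the edge lengths of $T$, and $\sin a_{ij}\neq 0$. Define, at $T$, $$P^{ij}_{rs}=\frac{1}{\sin(a_{ij})\sin(a_{rs})}\,\frac{\partial a_{ij}}{\partial x_{rs}} .$$ Then the following identities hold, where $i,j,k,l$ are pairwise distinct (so $\{i,j,k,l\}=\{1,2,3,4\}$) and $c_{rs}=\cos(a_{rs})$: (i) (Schläfli) $P^{ij}_{rs}=P^{rs}_{ij}$ for all pairs $\{i,j\},\{r,s\}$ of distinct indices in $\{1,2,3,4\}$. (ii) $P^{ij}_{kl}=P^{ik}_{jl}=P^{il}_{jk}$. (iii) $P^{ij}_{ik}=-P^{ij}_{kl}\cos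 a_{jk}$. (iv) $P^{ij}_{ij}=P^{ij}_{kl}\,w_{ij}$, where $$w_{ij}=\frac{c_{ij}c_{jk}c_{ki}+c_{ij}c_{jl}c_{li}+c_{ik}c_{jl}+c_{il}c_{jk}}{\sin^2(a_{ij})}.$$ (v) $P^{ij}_{rs}=P^{i'j'}_{r's'}$ for all pairs $\{i,j\}\neq\{r,s\}$ of distinct indices in $\{1,2,3,4\}$, where $\{a',b'\}$ denotes the complement of $\{a,b\}$ in $\{1,2,3,4\}$. -/

import Mathlib

open Topology

/-! ### Edges of a tetrahedron with vertices indexed by `Fin 4` -/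

/-- An edge is an unordered pair of distinct vertex labels. -/
abbrev Edge : Type := {e : Finset (Fin 4) // e.card = 2}

/-- The edge `{i, j}`. -/
def edge {i j : Fin 4} (h : i ≠ j) : Edge := ⟨{i, j}, Finset.card_pair h⟩

theorem Edge.nonempty (e : Edge) : e.1.Nonempty :=
  Finset.card_pos.mp (by rw [e.2]; norm_num)

/-- The smaller endpoint of an edge. -/
def Edge.fst (e : Edge) : Fin 4 := e.1.min' e.nonempty

/-- The larger endpoint of an edge. -/
def Edge.snd (e : Edge) : Fin 4 := e.1.max' e.nonempty

/-- The opposite edge: the complementary pair of labels. -/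
def Edge.opp (e : Edge) : Edge :=
  ⟨e.1ᶜ, by rw [Finset.card_compl, e.2, Fintype.card_fin]⟩

/-! ### Orthogonal components and angles for a symmetric form

`B` is the Euclidean inner product, or the Lorentz form, in which case the vectors for which
angles are taken are spacelike. -/

section Form

variable {V : Type} [AddCommGroup V] [Module ℝ V]

/-- The component of `w` that is `B`-orthogonal to `u`. -/
noncomputable def orthComponent (B : V → V → ℝ) (u w : V) : V := w - (B w u / B u u) • u

/-- The angle between two vectors with respect to `B`. -/
noncomputable def formAngle (B : V → V → ℝ) (u w : V) : ℝ :=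
  Real.arccos (B u w / (√(B u u) * √(B w w)))

/-- The angle between the half-planes bounded by the line `ℝ d` that contain `a` and `b`
respectively: the angle between the components of `a` and `b` orthogonal to `d`. -/
noncomputable def halfPlaneAngle (B : V → V → ℝ) (d a b : V) : ℝ :=
  formAngle B (orthComponent B d a) (orthComponent B d b)

end Form

/-! ### The three geometries and their tetrahedra -/

/-- The Lorentz form on `ℝ⁴`. -/
def lorentz (x y : Fin 4 → ℝ) : ℝ := -(x 0 * y 0) + x 1 * y 1 + x 2 * y 2 + x 3 * y 3

/-- A nondegenerate tetrahedron in the unit sphere `S³ ⊂ ℝ⁴`, given by its vertices. -/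
structure SphericalTetrahedron where
  vertex : Fin 4 → EuclideanSpace ℝ (Fin 4)
  norm_eq_one : ∀ i, ‖vertex i‖ = 1
  linearIndependent : LinearIndependent ℝ vertex

/-- A nondegenerate tetrahedron in hyperbolic 3-space, in the hyperboloid model. -/
structure HyperbolicTetrahedron where
  vertex : Fin 4 → (Fin 4 → ℝ)
  lorentz_self : ∀ i, lorentz (vertex i) (vertex i) = -1
  pos : ∀ i, 0 < vertex i 0
  linearIndependent : LinearIndependent ℝ vertex

/-- A nondegenerate tetrahedron in Euclidean 3-space. -/
structure EuclideanTetrahedron where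
  vertex : Fin 4 → EuclideanSpace ℝ (Fin 3)
  affineIndependent : AffineIndependent ℝ vertex

/-- The geometries `S³`, `H³` and `E³`. -/
inductive Geometry
  | spherical
  | hyperbolic
  | euclidean

/-- Nondegenerate tetrahedra with labelled vertices in the given geometry. -/
def Tetrahedron : Geometry → Type
  | .spherical => SphericalTetrahedron
  | .hyperbolic => HyperbolicTetrahedron
  | .euclidean => EuclideanTetrahedron

/-- The length of the geodesic edge `v_i v_j`. -/
noncomputable def SphericalTetrahedron.length (T : SphericalTetrahedron) (i j : Fin 4) : ℝ :=
  InnerProductGeometry.angle (T.vertex i) (T.vertex j)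

/-- The length of the geodesic edge `v_i v_j`. -/
noncomputable def HyperbolicTetrahedron.length (T : HyperbolicTetrahedron) (i j : Fin 4) : ℝ :=
  Real.arcosh (-lorentz (T.vertex i) (T.vertex j))

/-- The length of the edge `v_i v_j`. -/
noncomputable def EuclideanTetrahedron.length (T : EuclideanTetrahedron) (i j : Fin 4) : ℝ :=
  dist (T.vertex i) (T.vertex j)

/-- The dihedral angle at the edge `v_i v_j` between the faces through `v_k` and `v_l`, measured
in the tangent space at `v_i`. The component of `v_m` orthogonal to `v_i` is a positive multiple
of the initial velocity of the geodesic from `v_i` to `v_m`. -/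
noncomputable def SphericalTetrahedron.dihedral (T : SphericalTetrahedron)
    (i j k l : Fin 4) : ℝ :=
  let B : EuclideanSpace ℝ (Fin 4) → EuclideanSpace ℝ (Fin 4) → ℝ := fun x y => inner ℝ x y
  let dir : Fin 4 → EuclideanSpace ℝ (Fin 4) := fun m =>
    orthComponent B (T.vertex i) (T.vertex m)
  halfPlaneAngle B (dir j) (dir k) (dir l)

/-- The dihedral angle at the edge `v_i v_j` between the faces through `v_k` and `v_l`, measured
in the tangent space at `v_i`, on which the Lorentz form is positive definite. The component of
`v_m` Lorentz-orthogonal to `v_i` is a positive multiple of the initial velocity of the geodesic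
from `v_i` to `v_m`. -/
noncomputable def HyperbolicTetrahedron.dihedral (T : HyperbolicTetrahedron)
    (i j k l : Fin 4) : ℝ :=
  let dir : Fin 4 → (Fin 4 → ℝ) := fun m => orthComponent lorentz (T.vertex i) (T.vertex m)
  halfPlaneAngle lorentz (dir j) (dir k) (dir l)

/-- The dihedral angle at the edge `v_i v_j` between the faces through `v_k` and `v_l`. -/
noncomputable def EuclideanTetrahedron.dihedral (T : EuclideanTetrahedron)
    (i j k l : Fin 4) : ℝ :=
  let B : EuclideanSpace ℝ (Fin 3) → EuclideanSpace ℝ (Fin 3) → ℝ := fun x y => inner ℝ x y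
  let dir : Fin 4 → EuclideanSpace ℝ (Fin 3) := fun m => T.vertex m - T.vertex i
  halfPlaneAngle B (dir j) (dir k) (dir l)

/-- The edge length `x_{ij}` of a tetrahedron, for distinct `i, j`. -/
noncomputable def Tetrahedron.length : {g : Geometry} → Tetrahedron g → Fin 4 → Fin 4 → ℝ
  | .spherical, T => SphericalTetrahedron.length T
  | .hyperbolic, T => HyperbolicTetrahedron.length T
  | .euclidean, T => EuclideanTetrahedron.length T

/-- The dihedral angle `a_{ij}` of a tetrahedron, for distinct `i, j, k, l`. -/
noncomputable def Tetrahedron.dihedral :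
    {g : Geometry} → Tetrahedron g → Fin 4 → Fin 4 → Fin 4 → Fin 4 → ℝ
  | .spherical, T => SphericalTetrahedron.dihedral T
  | .hyperbolic, T => HyperbolicTetrahedron.dihedral T
  | .euclidean, T => EuclideanTetrahedron.dihedral T

/-- The vector of the six edge lengths. -/
noncomputable def Tetrahedron.lengths {g : Geometry} (T : Tetrahedron g) : Edge → ℝ :=
  fun e => T.length e.fst e.snd

/-- The vector of the six dihedral angles. -/
noncomputable def Tetrahedron.angles {g : Geometry} (T : Tetrahedron g) : Edge → ℝ :=
  fun e => T.dihedral e.fst e.snd e.opp.fst e.opp.snd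

/-! ### The dihedral angles as functions of the edge lengths -/

open Classical in
/-- The curvature map, sending the edge lengths of a tetrahedron to its dihedral angles: at `x`
it takes the angles of some tetrahedron with edge lengths `x` (and `0` if there is none). -/
noncomputable def curvatureMap (g : Geometry) (x : Edge → ℝ) : Edge → ℝ :=
  if h : ∃ T : Tetrahedron g, T.lengths = x then h.choose.angles else 0

/-- The partial derivative `∂a_e / ∂x_f` at `x`. -/
noncomputable def angleDeriv (g : Geometry) (x : Edge → ℝ) (e f : Edge) : ℝ :=
  deriv (fun t : ℝ => curvatureMap g (Function.update x f t) e) (x f)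

/-- The quantity `P^e_f = (1 / (sin a_e sin a_f)) ∂a_e / ∂x_f` at the lengths `x`. -/
noncomputable def angleP (g : Geometry) (x : Edge → ℝ) (e f : Edge) : ℝ :=
  1 / (Real.sin (curvatureMap g x e) * Real.sin (curvatureMap g x f)) * angleDeriv g x e f

/-! ### Edges -/

/-! Border the Gram matrix of the vertices to a 5×5 symmetric matrix M in which each length enters
only at two mirror entries. In the curved cases the extra vector is orthogonal to the vertices; in
the Euclidean case M is a Cayley–Menger matrix. Let N be its inverse. The entry N_ab is, up to
normalization, the product of the normals of the faces opposite v_a and v_b. With u_ab = N_ab /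
(√N_aa √N_bb), the dihedral angle at v_i v_j, where the faces opposite v_k and v_l meet, has cosine
-u_kl. The link with the geometric definition is that N restricted to j, k, l inverts the Gram
matrix of the tangent directions at v_i (`tangentGram_mul_faceGram`, `exists_faceGram_eq`).

Write m for the derivative of the entry M_rs in x_rs. From dN = -N dM N one gets dN_ab = -m (N_ar
N_bs + N_as N_br), hence ∂a_ij/∂x_rs (`hasDerivAt_faceAngle`), with a factor -m √N_rr √N_ss.
Jacobi's identity for complementary minors gives a sine law (`oppositeP_mul_sin`): this factor is P₀
sin a_rs, where P₀ = √|det M| ∏ √N_aa does not depend on the edge. Therefore P^{ij}_{rs} = P₀ (u_kr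
u_ls + u_ks u_lr - u_kl (u_kr u_ks + u_lr u_ls)) / sin² a_ij. For opposite edges the fraction is 1,
for edges ij and ik it is u_il = -cos a_jk, and for equal edges it is w_ij. All five identities can
be read off.

To differentiate the curvature map, every length vector near that of T must be realized by a
tetrahedron. Positivity of the tangent Gram matrix at one vertex is an open condition, and a
Cholesky factorization then supplies the vertices (`exists_tetrahedron`). So the curvature map
agrees near T with the explicit function of N. -/

theorem edge_comm {i j : Fin 4} (h : i ≠ j) : edge h = edge h.symm :=
  Subtype.ext (Finset.pair_comm i j)

theorem Edge.fst_ne_snd (e : Edge) : e.fst ≠ e.snd :=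
  (Finset.min'_lt_max'_of_card _ (by rw [e.2]; norm_num)).ne

theorem edge_fst_snd (e : Edge) : edge e.fst_ne_snd = e := by
  refine Subtype.ext (Finset.eq_of_subset_of_card_le ?_ ?_)
  · intro a ha
    simp only [edge, Finset.mem_insert, Finset.mem_singleton] at ha
    rcases ha with rfl | rfl
    · exact Finset.min'_mem _ _
    · exact Finset.max'_mem _ _
  · rw [e.2, (edge e.fst_ne_snd).2]

theorem edge_ends {α : Type*} (F : Fin 4 → Fin 4 → α) (hF : ∀ i j, F i j = F j i)
    {i j : Fin 4} (h : i ≠ j) : F (edge h).fst (edge h).snd = F i j := by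
  rcases lt_or_gt_of_ne h with hlt | hlt
  · have h1 : (edge h).fst = i := by
      simp [Edge.fst, edge, Finset.min'_insert, hlt.le]
    have h2 : (edge h).snd = j := by
      simp [Edge.snd, edge, Finset.max'_insert, hlt.le]
    rw [h1, h2]
  · have h1 : (edge h).fst = j := by
      simp [Edge.fst, edge, Finset.min'_insert, hlt.le]
    have h2 : (edge h).snd = i := by
      simp [Edge.snd, edge, Finset.max'_insert, hlt.le]
    rw [h1, h2, hF]

theorem edge_inj {i j k l : Fin 4} {hij : i ≠ j} {hkl : k ≠ l} :
    edge hij = edge hkl ↔ i = k ∧ j = l ∨ i = l ∧ j = k := by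
  revert i j k l
  decide

theorem opp_edge {i j k l : Fin 4} (hij : i ≠ j) (hkl : k ≠ l) (h : [i, j, k, l].Nodup) :
    (edge hij).opp = edge hkl := by
  revert i j k l
  decide

theorem Edge.exists_rep (e : Edge) :
    ∃ (i j k l : Fin 4) (hij : i ≠ j), [i, j, k, l].Nodup ∧ e = edge hij := by
  have key : ∀ i j : Fin 4, i ≠ j → ∃ k l, [i, j, k, l].Nodup := by decide
  obtain ⟨k, l, h⟩ := key _ _ e.fst_ne_snd
  exact ⟨_, _, k, l, e.fst_ne_snd, h, (edge_fst_snd e).symm⟩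

/-- Two edges are equal, opposite, or have exactly one common vertex. -/
theorem Edge.trichotomy (e f : Edge) : e = f ∨ f = e.opp ∨
    ∃ (i j k l : Fin 4) (hij : i ≠ j) (hik : i ≠ k), [i, j, k, l].Nodup ∧
      e = edge hij ∧ f = edge hik := by
  obtain ⟨i, j, k, l, hij, h, rfl⟩ := e.exists_rep
  have hkl : k ≠ l := by simp at h; tauto
  rw [opp_edge hij hkl h]
  have key : ∀ i j k l r s : Fin 4, [i, j, k, l].Nodup → r ≠ s →
      (r = i ∧ s = j ∨ r = j ∧ s = i) ∨ (r = k ∧ s = l ∨ r = l ∧ s = k) ∨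
      (∃ m n, [i, j, m, n].Nodup ∧ (r = i ∧ s = m ∨ r = m ∧ s = i)) ∨
      (∃ m n, [j, i, m, n].Nodup ∧ (r = j ∧ s = m ∨ r = m ∧ s = j)) := by
    decide
  rw [← edge_fst_snd f]
  rcases key i j k l f.fst f.snd h f.fst_ne_snd with H | H | ⟨m, n, hn, H⟩ | ⟨m, n, hn, H⟩
  · left; rw [edge_inj]; tauto
  · right; left; rw [edge_inj]; tauto
  · have him : i ≠ m := by simp at hn; tauto
    exact .inr (.inr ⟨i, j, m, n, hij, him, hn, rfl, edge_inj.2 H⟩)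
  · have him : j ≠ m := by simp at hn; tauto
    exact .inr (.inr ⟨j, i, m, n, hij.symm, him, hn, edge_comm _, edge_inj.2 H⟩)

theorem sum_fin_four_of_nodup {α : Type*} [AddCommMonoid α] {i j k l : Fin 4}
    (h : [i, j, k, l].Nodup) (f : Fin 4 → α) : ∑ a, f a = f i + f j + f k + f l := by
  have key : ∀ i j k l : Fin 4, [i, j, k, l].Nodup →
      (Finset.univ : Finset (Fin 4)) = {i, j, k, l} := by decide
  rw [key i j k l h]
  simp only [List.nodup_cons, List.mem_cons, List.not_mem_nil, or_false, not_or] at h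
  rw [Finset.sum_insert (by simp; tauto), Finset.sum_insert (by simp; tauto),
    Finset.sum_pair (by tauto), add_assoc, add_assoc]

/-! ### Positive ternary quadratic forms -/

/-- The leading principal minors of `!![A, D, E; D, B, F; E, F, C]` are positive. -/
def PosMinors (A B C D E F : ℝ) : Prop :=
  0 < A ∧ 0 < A * B - D ^ 2 ∧
    0 < A * (B * C - F ^ 2) - D * (D * C - E * F) + E * (D * F - B * E)

theorem posMinors_of_pos {A B C D E F : ℝ}
    (h : ∀ p q r : ℝ, ¬(p = 0 ∧ q = 0 ∧ r = 0) →
      0 < p ^ 2 * A + q ^ 2 * B + r ^ 2 * C + 2 * p * q * D + 2 * p * r * E + 2 * q * r * F) :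
    PosMinors A B C D E F := by
  have hA : 0 < A := by simpa using h 1 0 0 (by simp)
  have h2 : 0 < A * B - D ^ 2 := by
    -- At this vector the form takes the value A (A B - D²).
    have := h (-D) A 0 (by simp [hA.ne'])
    refine pos_of_mul_pos_right (a := A) ?_ hA.le
    linarith
  refine ⟨hA, h2, ?_⟩
  -- The last row of the adjugate: the form takes there the value (A B - D²) times the determinant.
  have := h (D * F - B * E) (D * E - A * F) (A * B - D ^ 2) (by simp [h2.ne'])
  refine pos_of_mul_pos_right (a := A * B - D ^ 2) ?_ h2.le
  linarith

/-- Cholesky decomposition of a positive ternary form. -/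
theorem PosMinors.exists_cholesky {A B C D E F : ℝ} (h : PosMinors A B C D E F) :
    ∃ a b c d e f : ℝ, 0 < a ∧ 0 < c ∧ 0 < f ∧ a ^ 2 = A ∧ a * b = D ∧ b ^ 2 + c ^ 2 = B ∧
      a * d = E ∧ b * d + c * e = F ∧ d ^ 2 + e ^ 2 + f ^ 2 = C := by
  obtain ⟨hA, h2, h3⟩ := h
  obtain ⟨a, ha, rfl⟩ : ∃ a, 0 < a ∧ a ^ 2 = A := ⟨√A, Real.sqrt_pos.2 hA, Real.sq_sqrt hA.le⟩
  obtain ⟨b, rfl⟩ : ∃ b, a * b = D := ⟨D / a, by field_simp⟩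
  have hc : 0 < B - b ^ 2 := by
    refine pos_of_mul_pos_right (a := a ^ 2) ?_ hA.le
    linarith
  obtain ⟨c, hc0, hc'⟩ : ∃ c, 0 < c ∧ c ^ 2 = B - b ^ 2 :=
    ⟨_, Real.sqrt_pos.2 hc, Real.sq_sqrt hc.le⟩
  obtain rfl : B = b ^ 2 + c ^ 2 := by linarith
  obtain ⟨d, rfl⟩ : ∃ d, a * d = E := ⟨E / a, by field_simp⟩
  obtain ⟨e, rfl⟩ : ∃ e, b * d + c * e = F := ⟨(F - b * d) / c, by field_simp; ring⟩
  have hf : 0 < C - d ^ 2 - e ^ 2 := by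
    refine pos_of_mul_pos_right (a := a ^ 2 * c ^ 2) ?_ (by positivity)
    linarith
  refine ⟨a, b, c, d, e, √(C - d ^ 2 - e ^ 2), ha, hc0, Real.sqrt_pos.2 hf, rfl, rfl, rfl, rfl,
    rfl, ?_⟩
  rw [Real.sq_sqrt hf.le]; ring

/-! ### Minors of inverse matrices -/

/-- Jacobi's identity for complementary minors, in block form. -/
theorem Matrix.det_mul_det_block_of_mul_eq_one {m n R : Type*} [Fintype m] [Fintype n]
    [DecidableEq m] [DecidableEq n] [CommRing R] {M N : Matrix (m ⊕ n) (m ⊕ n) R}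
    (h : M * N = 1) : M.det * N.toBlocks₁₁.det = M.toBlocks₂₂.det := by
  -- Keep the first block column of N and complete it by the identity: the product with M is block
  -- triangular, and determinants give the claim.
  have key : M * fromBlocks N.toBlocks₁₁ 0 N.toBlocks₂₁ 1 =
      fromBlocks 1 M.toBlocks₁₂ 0 M.toBlocks₂₂ := by
    conv_lhs => rw [← fromBlocks_toBlocks M]
    rw [← fromBlocks_toBlocks M, ← fromBlocks_toBlocks N, fromBlocks_multiply,
      ← fromBlocks_one, fromBlocks_inj] at h
    rw [fromBlocks_multiply, fromBlocks_inj]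
    simp [h.1, h.2.2.1]
  have := congrArg det key
  simpa [det_fromBlocks_zero₁₂, det_fromBlocks_zero₂₁] using this

/-- Cramer's rule: the entries are polynomials in those of M divided by the determinant. -/
theorem Matrix.differentiableAt_inv_apply {n E : Type*} [Fintype n] [DecidableEq n]
    [NormedAddCommGroup E] [NormedSpace ℝ E] {M : E → Matrix n n ℝ} {x : E}
    (hM : ∀ a b, DifferentiableAt ℝ (fun y => M y a b) x) (hdet : (M x).det ≠ 0) (a b : n) :
    DifferentiableAt ℝ (fun y => (M y)⁻¹ a b) x := by
  have hd : ∀ {F : E → Matrix n n ℝ}, (∀ a b, DifferentiableAt ℝ (fun y => F y a b) x) →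
      DifferentiableAt ℝ (fun y => (F y).det) x := by
    intro F hF
    simp only [det_apply]
    refine DifferentiableAt.fun_sum fun σ _ => ?_
    have hp : DifferentiableAt ℝ (fun y => ∏ i, F y (σ i) i) x :=
      (HasFDerivAt.finsetProd fun i _ => (hF (σ i) i).hasFDerivAt).differentiableAt
    simpa only [Units.smul_def, zsmul_eq_mul] using hp.const_mul _
  simp only [Matrix.inv_def, Matrix.smul_apply, Ring.inverse_eq_inv', adjugate_apply, smul_eq_mul]
  refine ((hd hM).inv hdet).mul (hd fun c d => ?_)
  by_cases hc : c = b
  · subst hc; simp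
  · simp [updateRow_ne hc, hM]

/-- The derivative of an entry of the inverse of a matrix-valued function. -/
theorem Matrix.hasDerivAt_inv_apply {n : Type*} [Fintype n] [DecidableEq n]
    {M : ℝ → Matrix n n ℝ} {M' : Matrix n n ℝ} {t : ℝ}
    (hM : ∀ a b, HasDerivAt (fun s => M s a b) (M' a b) t) (hdet : (M t).det ≠ 0) (a b : n) :
    HasDerivAt (fun s => (M s)⁻¹ a b) (-((M t)⁻¹ * M' * (M t)⁻¹) a b) t := by
  have hN := fun c d => (differentiableAt_inv_apply (x := t)
    (fun a b => (hM a b).differentiableAt) hdet c d).hasDerivAt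
  set N' : Matrix n n ℝ := of fun c d => deriv (fun s => (M s)⁻¹ c d) t with hN'
  have hev : ∀ᶠ s in 𝓝 t, (M s).det ≠ 0 := by
    have hc : ContinuousAt (fun s => (M s).det) t :=
      (continuous_id.matrix_det.continuousAt (x := M t)).comp
        (continuousAt_pi.2 fun a => continuousAt_pi.2 fun b => (hM a b).continuousAt)
    exact hc.eventually_ne hdet
  -- Differentiate M⁻¹ M = 1, which holds near t because the determinant stays nonzero.
  have hzero : N' * M t + (M t)⁻¹ * M' = 0 := by
    ext c d
    have h1 : HasDerivAt (fun s => ((M s)⁻¹ * M s) c d)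
        (∑ i, (N' c i * M t i d + (M t)⁻¹ c i * M' i d)) t := by
      simp only [mul_apply]
      exact HasDerivAt.fun_sum fun i _ => (hN c i).mul (hM i d)
    have h2 : (fun s => ((M s)⁻¹ * M s) c d) =ᶠ[𝓝 t] fun _ => (1 : Matrix n n ℝ) c d := by
      filter_upwards [hev] with s hs
      rw [nonsing_inv_mul _ (isUnit_iff_ne_zero.2 hs)]
    rw [add_apply, mul_apply, mul_apply, ← Finset.sum_add_distrib]
    exact h1.unique ((hasDerivAt_const t _).congr_of_eventuallyEq h2)
  have : -((M t)⁻¹ * M' * (M t)⁻¹) = N' := by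
    rw [← eq_neg_iff_add_eq_zero] at hzero
    rw [← Matrix.neg_mul, ← hzero, Matrix.mul_assoc,
      mul_nonsing_inv _ (isUnit_iff_ne_zero.2 hdet), Matrix.mul_one]
  have h3 := congrFun (congrFun this a) b
  rw [neg_apply] at h3
  rw [h3]
  exact hN a b

/-! ### Gram matrices as functions of the edge lengths -/

namespace Geometry

/-- The product of the vectors representing two points at distance `t`. In the Euclidean case
points are represented by lightlike vectors. -/
noncomputable def gramFun : Geometry → ℝ → ℝ
  | spherical, t => Real.cos t
  | hyperbolic, t => -Real.cosh t
  | euclidean, t => -t ^ 2 / 2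

/-- The derivative of `gramFun`. -/
noncomputable def gramFunDeriv : Geometry → ℝ → ℝ
  | spherical, t => -Real.sin t
  | hyperbolic, t => -Real.sinh t
  | euclidean, t => -t

/-- The product of the additional vector bordering the Gram matrix with itself. -/
def corner : Geometry → ℝ
  | spherical => 1
  | hyperbolic => 1
  | euclidean => 0

/-- The product of the additional vector bordering the Gram matrix with the vertices. -/
def border : Geometry → ℝ
  | spherical => 0
  | hyperbolic => 0
  | euclidean => 1

/-- The sign of the determinant of the bordered Gram matrix. -/
def sign : Geometry → ℝ
  | spherical => 1
  | hyperbolic => -1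
  | euclidean => -1

theorem hasDerivAt_gramFun (g : Geometry) (t : ℝ) :
    HasDerivAt g.gramFun (g.gramFunDeriv t) t := by
  cases g
  · exact Real.hasDerivAt_cos t
  · exact (Real.hasDerivAt_cosh t).neg
  · have := ((hasDerivAt_pow 2 t).neg).div_const 2
    refine this.congr_deriv ?_
    simp only [gramFunDeriv]; push_cast; ring

/-- The Gram matrix of the vertices. -/
noncomputable def vertexGram (g : Geometry) (x : Edge → ℝ) (a b : Fin 4) : ℝ :=
  if h : a = b then g.gramFun 0 else g.gramFun (x (edge h))

theorem vertexGram_self (g : Geometry) (x : Edge → ℝ) (a : Fin 4) :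
    g.vertexGram x a a = g.gramFun 0 := dif_pos rfl

theorem vertexGram_of_ne (g : Geometry) (x : Edge → ℝ) {a b : Fin 4} (h : a ≠ b) :
    g.vertexGram x a b = g.gramFun (x (edge h)) := dif_neg h

theorem vertexGram_comm (g : Geometry) (x : Edge → ℝ) (a b : Fin 4) :
    g.vertexGram x a b = g.vertexGram x b a := by
  by_cases h : a = b
  · rw [h]
  · rw [vertexGram_of_ne g x h, vertexGram_of_ne g x (Ne.symm h), edge_comm]

theorem differentiable_vertexGram (g : Geometry) (a b : Fin 4) :
    Differentiable ℝ fun x : Edge → ℝ => g.vertexGram x a b := by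
  intro x
  by_cases h : a = b
  · simp [vertexGram, h]
  · simp only [vertexGram_of_ne g _ h]
    exact (g.hasDerivAt_gramFun _).differentiableAt.comp x (differentiableAt_apply (edge h) x)

/-- The Gram matrix of the vertices and one additional vector: it is orthogonal to the vertices
in the curved geometries, and the point at infinity in the Euclidean one, where this is a
Cayley–Menger matrix. -/
noncomputable def borderedGram (g : Geometry) (x : Edge → ℝ) :
    Matrix (Option (Fin 4)) (Option (Fin 4)) ℝ :=
  Matrix.of fun a b => a.elim (b.elim g.corner fun _ => g.border) fun a' =>
    b.elim g.border (g.vertexGram x a')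

section
variable (g : Geometry) (x : Edge → ℝ) (a b : Fin 4)

@[simp] theorem borderedGram_none_none : g.borderedGram x none none = g.corner := rfl
@[simp] theorem borderedGram_none_some : g.borderedGram x none (some b) = g.border := rfl
@[simp] theorem borderedGram_some_none : g.borderedGram x (some a) none = g.border := rfl
@[simp] theorem borderedGram_some_some :
    g.borderedGram x (some a) (some b) = g.vertexGram x a b := rfl

end

theorem borderedGram_transpose (g : Geometry) (x : Edge → ℝ) :
    (g.borderedGram x).transpose = g.borderedGram x := by
  ext (_ | a) (_ | b)
  · rfl
  · rfl
  · rfl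
  · exact vertexGram_comm g x b a

/-- The products of the vectors at `v_i` pointing to the other vertices. -/
noncomputable def tangentGram : Geometry → (Edge → ℝ) → Fin 4 → Fin 4 → Fin 4 → ℝ
  | spherical, x, i, a, b => vertexGram spherical x a b -
      vertexGram spherical x a i * vertexGram spherical x b i
  | hyperbolic, x, i, a, b => vertexGram hyperbolic x a b +
      vertexGram hyperbolic x a i * vertexGram hyperbolic x b i
  | euclidean, x, i, a, b => vertexGram euclidean x a b -
      vertexGram euclidean x a i - vertexGram euclidean x b i

theorem tangentGram_comm (g : Geometry) (x : Edge → ℝ) (i a b : Fin 4) :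
    g.tangentGram x i a b = g.tangentGram x i b a := by
  cases g <;> simp only [tangentGram, vertexGram_comm _ x a b] <;> ring

theorem tangentGram_left (g : Geometry) (x : Edge → ℝ) (i b : Fin 4) :
    g.tangentGram x i i b = 0 := by
  cases g <;> simp only [tangentGram, vertexGram_self, vertexGram_comm _ x i b, gramFun] <;> simp

/-- The tangent Gram matrix is a Schur complement of the bordered one: subtracting multiples of the
rows of v_i and of the extra vector clears the border column. This treats the three geometries at
once. -/
theorem tangentGram_eq (g : Geometry) (x : Edge → ℝ) (i a : Fin 4) :
    ∃ s t : ℝ, (∀ b, g.tangentGram x i a b =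
      g.vertexGram x a b - s * g.vertexGram x i b - t * g.border) ∧
      g.border - s * g.border - t * g.corner = 0 := by
  cases g
  · refine ⟨vertexGram spherical x a i, 0, fun b => ?_, ?_⟩
    · simp only [tangentGram, vertexGram_comm _ x i b]; ring
    · simp [border]
  · refine ⟨-vertexGram hyperbolic x a i, 0, fun b => ?_, ?_⟩
    · simp only [tangentGram, vertexGram_comm _ x i b]; ring
    · simp [border]
  · refine ⟨1, vertexGram euclidean x a i, fun b => ?_, ?_⟩
    · simp only [tangentGram, vertexGram_comm _ x i b, border]; ring
    · simp [border, corner]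

/-- The products of tangent vectors at `v_i` to the edges ending in `v_j`, `v_k`, `v_l` are
positive definite. -/
def TangentPos (g : Geometry) (x : Edge → ℝ) (i j k l : Fin 4) : Prop :=
  PosMinors (g.tangentGram x i j j) (g.tangentGram x i k k) (g.tangentGram x i l l)
    (g.tangentGram x i j k) (g.tangentGram x i j l) (g.tangentGram x i k l)

/-- The lengths have the properties of the edge lengths of a nondegenerate tetrahedron that
concern the Gram matrices. -/
structure Admissible (g : Geometry) (x : Edge → ℝ) : Prop where
  deriv_neg : ∀ e, g.gramFunDeriv (x e) < 0
  tangentPos : ∀ {i j k l : Fin 4}, [i, j, k, l].Nodup → g.TangentPos x i j k l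

namespace Admissible

variable {g : Geometry} {x : Edge → ℝ}

/-- The row operations of `tangentGram_eq` turn a kernel vector into a solution of the 3×3 tangent
system at vertex 0, so three coordinates vanish; the rows of vertex 0 and of the border remove the
other two. -/
theorem det_ne_zero (hx : g.Admissible x) : (g.borderedGram x).det ≠ 0 := by
  intro h0
  obtain ⟨c, hc, hMc⟩ := Matrix.exists_mulVec_eq_zero_iff.2 h0
  apply hc
  have hrow : ∀ a, g.vertexGram x a 0 * c (some 0) + g.vertexGram x a 1 * c (some 1) +
      g.vertexGram x a 2 * c (some 2) + g.vertexGram x a 3 * c (some 3) +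
      g.border * c none = 0 := by
    intro a
    have := congrFun hMc (some a)
    simp only [Matrix.mulVec, dotProduct, Fintype.sum_option, Fin.sum_univ_four,
      borderedGram_some_none, borderedGram_some_some, Pi.zero_apply] at this
    linarith
  have hnone : g.border * (c (some 0) + c (some 1) + c (some 2) + c (some 3)) +
      g.corner * c none = 0 := by
    have := congrFun hMc none
    simp only [Matrix.mulVec, dotProduct, Fintype.sum_option, Fin.sum_univ_four,
      borderedGram_none_none, borderedGram_none_some, Pi.zero_apply] at this
    linarith
  have htan : ∀ a, g.tangentGram x 0 a 1 * c (some 1) + g.tangentGram x 0 a 2 * c (some 2) +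
      g.tangentGram x 0 a 3 * c (some 3) = 0 := by
    intro a
    obtain ⟨s, t, h1, h2⟩ := g.tangentGram_eq x 0 a
    have h3 := h1 0
    rw [tangentGram_comm, tangentGram_left] at h3
    rw [h1, h1, h1]
    linear_combination hrow a - s * hrow 0 - t * hnone + c (some 0) * h3 - c none * h2
  have hpos := hx.tangentPos (i := 0) (j := 1) (k := 2) (l := 3) (by decide)
  obtain ⟨-, -, hdet⟩ := hpos
  have e1 := htan 1
  have e2 := htan 2
  have e3 := htan 3
  rw [tangentGram_comm g x 0 2 1] at e2
  rw [tangentGram_comm g x 0 3 1, tangentGram_comm g x 0 3 2] at e3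
  generalize g.tangentGram x 0 1 1 = A at *
  generalize g.tangentGram x 0 2 2 = B at *
  generalize g.tangentGram x 0 3 3 = C at *
  generalize g.tangentGram x 0 1 2 = D at *
  generalize g.tangentGram x 0 1 3 = E at *
  generalize g.tangentGram x 0 2 3 = F at *
  -- The coefficients here and in the next two steps are the rows of the adjugate of the tangent
  -- Gram matrix.
  have c1 : c (some 1) = 0 := by
    refine (mul_eq_zero.1 ?_).resolve_left hdet.ne'
    linear_combination (B * C - F ^ 2) * e1 + (E * F - C * D) * e2 + (D * F - B * E) * e3
  have c2 : c (some 2) = 0 := by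
    refine (mul_eq_zero.1 ?_).resolve_left hdet.ne'
    linear_combination (E * F - C * D) * e1 + (A * C - E ^ 2) * e2 + (D * E - A * F) * e3
  have c3 : c (some 3) = 0 := by
    refine (mul_eq_zero.1 ?_).resolve_left hdet.ne'
    linear_combination (D * F - B * E) * e1 + (D * E - A * F) * e2 + (A * B - D ^ 2) * e3
  have h0 := hrow 0
  rw [c1, c2, c3, vertexGram_self] at h0
  rw [c1, c2, c3] at hnone
  have c0 : c (some 0) = 0 ∧ c none = 0 := by
    cases g <;> simp_all [gramFun, border, corner]
  funext a
  rcases a with _ | a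
  · exact c0.2
  · fin_cases a
    exacts [c0.1, c1, c2, c3]

end Admissible

/-- The products of the (outward or inward) normals of the faces, up to normalization. -/
noncomputable def faceGram (g : Geometry) (x : Edge → ℝ) (a b : Fin 4) : ℝ :=
  (g.borderedGram x)⁻¹ (some a) (some b)

theorem faceGram_comm (g : Geometry) (x : Edge → ℝ) (a b : Fin 4) :
    g.faceGram x a b = g.faceGram x b a := by
  have h : ((g.borderedGram x)⁻¹).transpose = (g.borderedGram x)⁻¹ := by
    rw [Matrix.transpose_nonsing_inv, borderedGram_transpose]
  exact congrFun (congrFun h (some b)) (some a)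

/-- A block of an inverse matrix is the inverse of the complementary Schur complement. Applied to M
N = 1, the row operations clear the terms in v_i and the border. -/
theorem Admissible.tangentGram_mul_faceGram {g : Geometry} {x : Edge → ℝ} (hx : g.Admissible x)
    {i j k l : Fin 4} (h : [i, j, k, l].Nodup) (a c : Fin 4) (hc : i ≠ c) :
    g.tangentGram x i a j * g.faceGram x j c + g.tangentGram x i a k * g.faceGram x k c +
      g.tangentGram x i a l * g.faceGram x l c = if a = c then 1 else 0 := by
  have hMN : g.borderedGram x * (g.borderedGram x)⁻¹ = 1 :=
    Matrix.mul_nonsing_inv _ (isUnit_iff_ne_zero.2 hx.det_ne_zero)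
  have hrow : ∀ a, g.vertexGram x a i * g.faceGram x i c + g.vertexGram x a j * g.faceGram x j c +
      g.vertexGram x a k * g.faceGram x k c + g.vertexGram x a l * g.faceGram x l c +
      g.border * (g.borderedGram x)⁻¹ none (some c) = if a = c then 1 else 0 := by
    intro a
    have := congrFun (congrFun hMN (some a)) (some c)
    simp only [Matrix.mul_apply, Fintype.sum_option, sum_fin_four_of_nodup h,
      borderedGram_some_none, borderedGram_some_some, Matrix.one_apply, Option.some_inj] at this
    rw [← this]
    simp only [faceGram]
    ring
  have hnone : g.border * (g.faceGram x i c + g.faceGram x j c + g.faceGram x k c +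
      g.faceGram x l c) + g.corner * (g.borderedGram x)⁻¹ none (some c) = 0 := by
    have := congrFun (congrFun hMN none) (some c)
    simp only [Matrix.mul_apply, Fintype.sum_option, sum_fin_four_of_nodup h,
      borderedGram_none_none, borderedGram_none_some, Matrix.one_apply, reduceCtorEq,
      if_false] at this
    rw [← this]
    simp only [faceGram]
    ring
  obtain ⟨s, t, h1, h2⟩ := g.tangentGram_eq x i a
  have h3 := h1 i
  rw [tangentGram_comm, tangentGram_left] at h3
  have hi := hrow i
  rw [if_neg hc] at hi
  rw [h1, h1, h1]
  linear_combination hrow a - s * hi - t * hnone + g.faceGram x i c * h3 -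
    (g.borderedGram x)⁻¹ none (some c) * h2

namespace Admissible

variable {g : Geometry} {x : Edge → ℝ}

/-- Products of face normals in terms of the tangent vectors at a vertex. -/
theorem exists_faceGram_eq (hx : g.Admissible x) {i j k l : Fin 4} (h : [i, j, k, l].Nodup) :
    ∃ δ : ℝ, 0 < δ ∧
      g.faceGram x k k = (g.tangentGram x i j j * g.tangentGram x i l l -
        g.tangentGram x i j l ^ 2) * δ ∧
      g.faceGram x l l = (g.tangentGram x i j j * g.tangentGram x i k k -
        g.tangentGram x i j k ^ 2) * δ ∧
      g.faceGram x k l = -(g.tangentGram x i j j * g.tangentGram x i k l -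
        g.tangentGram x i j k * g.tangentGram x i j l) * δ ∧
      0 < g.faceGram x k k * g.faceGram x l l - g.faceGram x k l ^ 2 := by
  obtain ⟨hA, -, hdet⟩ := hx.tangentPos h
  simp only [List.nodup_cons, List.mem_cons, List.not_mem_nil, or_false, not_or,
    not_false_eq_true] at h
  have hn : [i, j, k, l].Nodup := by simp; tauto
  have e1 := fun a => hx.tangentGram_mul_faceGram hn a k h.1.2.1
  have e2 := fun a => hx.tangentGram_mul_faceGram hn a l h.1.2.2
  have j1 := e1 j
  have k1 := e1 k
  have l1 := e1 l
  have j2 := e2 j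
  have k2 := e2 k
  have l2 := e2 l
  rw [if_neg h.2.1.1] at j1
  rw [if_neg h.2.1.2] at j2
  rw [if_pos rfl, tangentGram_comm g x i k j] at k1
  rw [if_neg h.2.2.1, tangentGram_comm g x i k j] at k2
  rw [if_neg (Ne.symm h.2.2.1), tangentGram_comm g x i l j, tangentGram_comm g x i l k] at l1
  rw [if_pos rfl, tangentGram_comm g x i l j, tangentGram_comm g x i l k] at l2
  rw [faceGram_comm g x l k] at j1 k1 l1
  generalize g.tangentGram x i j j = A at *
  generalize g.tangentGram x i k k = B at *
  generalize g.tangentGram x i l l = C at *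
  generalize g.tangentGram x i j k = D at *
  generalize g.tangentGram x i j l = E at *
  generalize g.tangentGram x i k l = F at *
  -- Solve the 3×3 system by the adjugate; δ is the inverse of the tangent determinant.
  have hkk : g.faceGram x k k = (A * C - E ^ 2) *
      (A * (B * C - F ^ 2) - D * (D * C - E * F) + E * (D * F - B * E))⁻¹ := by
    rw [eq_mul_inv_iff_mul_eq₀ hdet.ne']
    linear_combination (E * F - C * D) * j1 + (A * C - E ^ 2) * k1 + (D * E - A * F) * l1
  have hll : g.faceGram x l l = (A * B - D ^ 2) *
      (A * (B * C - F ^ 2) - D * (D * C - E * F) + E * (D * F - B * E))⁻¹ := by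
    rw [eq_mul_inv_iff_mul_eq₀ hdet.ne']
    linear_combination (D * F - B * E) * j2 + (D * E - A * F) * k2 + (A * B - D ^ 2) * l2
  have hkl : g.faceGram x k l = -(A * F - D * E) *
      (A * (B * C - F ^ 2) - D * (D * C - E * F) + E * (D * F - B * E))⁻¹ := by
    rw [eq_mul_inv_iff_mul_eq₀ hdet.ne']
    linear_combination (E * F - C * D) * j2 + (A * C - E ^ 2) * k2 + (D * E - A * F) * l2
  refine ⟨_, inv_pos.2 hdet, hkk, hll, hkl, ?_⟩
  rw [hkk, hll, hkl]
  -- A 2×2 minor of the adjugate equals A times the determinant.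
  have : 0 < A * (A * (B * C - F ^ 2) - D * (D * C - E * F) + E * (D * F - B * E)) *
      (A * (B * C - F ^ 2) - D * (D * C - E * F) + E * (D * F - B * E))⁻¹ ^ 2 := by positivity
  linarith

theorem faceGram_self_pos (hx : g.Admissible x) (a : Fin 4) : 0 < g.faceGram x a a := by
  have key : ∀ a : Fin 4, ∃ i j k, [i, j, k, a].Nodup := by decide
  obtain ⟨i, j, k, h⟩ := key a
  obtain ⟨δ, hδ, -, h1, -⟩ := hx.exists_faceGram_eq h
  rw [h1]
  exact mul_pos (hx.tangentPos h).2.1 hδ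

theorem faceGram_minor_pos (hx : g.Admissible x) {k l : Fin 4} (hkl : k ≠ l) :
    0 < g.faceGram x k k * g.faceGram x l l - g.faceGram x k l ^ 2 := by
  have key : ∀ k l : Fin 4, k ≠ l → ∃ i j, [i, j, k, l].Nodup := by decide
  obtain ⟨i, j, h⟩ := key k l hkl
  exact (hx.exists_faceGram_eq h).choose_spec.2.2.2.2

/-- Jacobi's identity for the splitting into {i, j} and {border, k, l}. The complementary minor
involves the single length x_kl and is sin², -sinh² or -x_kl² in the three geometries. -/
theorem det_mul_faceGram_minor (hx : g.Admissible x) {i j k l : Fin 4}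
    (h : [i, j, k, l].Nodup) (hkl : k ≠ l) :
    (g.borderedGram x).det * (g.faceGram x i i * g.faceGram x j j - g.faceGram x i j ^ 2) =
      g.sign * g.gramFunDeriv (x (edge hkl)) ^ 2 := by
  have hinj : ∀ i j k l : Fin 4, [i, j, k, l].Nodup → Function.Injective
      (Sum.elim ![some i, some j] ![none, some k, some l] : Fin 2 ⊕ Fin 3 → Option (Fin 4)) := by
    decide
  let σ : Fin 2 ⊕ Fin 3 ≃ Option (Fin 4) :=
    Equiv.ofBijective _ ((Fintype.bijective_iff_injective_and_card _).2 ⟨hinj i j k l h, by simp⟩)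
  have hMN : g.borderedGram x * (g.borderedGram x)⁻¹ = 1 :=
    Matrix.mul_nonsing_inv _ (isUnit_iff_ne_zero.2 hx.det_ne_zero)
  have h1 : (g.borderedGram x).submatrix σ σ * (g.borderedGram x)⁻¹.submatrix σ σ = 1 := by
    rw [Matrix.submatrix_mul_equiv, hMN, Matrix.submatrix_one_equiv]
  have h2 := Matrix.det_mul_det_block_of_mul_eq_one h1
  rw [Matrix.det_submatrix_equiv_self, Matrix.det_fin_two, Matrix.det_fin_three] at h2
  have h3 : g.faceGram x i i * g.faceGram x j j - g.faceGram x i j ^ 2 =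
      g.faceGram x i i * g.faceGram x j j - g.faceGram x i j * g.faceGram x j i := by
    rw [faceGram_comm g x j i]; ring
  rw [h3]
  refine h2.trans ?_
  change g.corner * g.vertexGram x k k * g.vertexGram x l l
    - g.corner * g.vertexGram x k l * g.vertexGram x l k
    - g.border * g.border * g.vertexGram x l l + g.border * g.vertexGram x k l * g.border
    + g.border * g.border * g.vertexGram x l k - g.border * g.vertexGram x k k * g.border = _
  rw [vertexGram_comm g x l k, vertexGram_of_ne g x hkl, vertexGram_self, vertexGram_self]
  cases g
  · simp only [corner, border, gramFun, gramFunDeriv, sign, Real.cos_zero]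
    linear_combination -Real.sin_sq_add_cos_sq (x (edge hkl))
  · simp only [corner, border, gramFun, gramFunDeriv, sign, Real.cosh_zero]
    linear_combination -Real.cosh_sq (x (edge hkl))
  · simp only [corner, border, gramFun, gramFunDeriv, sign]
    ring

end Admissible

end Geometry

theorem HasDerivAt.div_sqrt_mul_sqrt {p q r : ℝ → ℝ} {p' q' r' t : ℝ} (hp : HasDerivAt p p' t)
    (hq : HasDerivAt q q' t) (hr : HasDerivAt r r' t) (hq0 : 0 < q t) (hr0 : 0 < r t) :
    HasDerivAt (fun s => p s / (√(q s) * √(r s)))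
      ((p' - p t / 2 * (q' / q t + r' / r t)) / (√(q t) * √(r t))) t := by
  have h1 : 0 < √(q t) := Real.sqrt_pos.2 hq0
  have h2 : 0 < √(r t) := Real.sqrt_pos.2 hr0
  refine (hp.div ((hq.sqrt hq0.ne').mul (hr.sqrt hr0.ne')) (mul_pos h1 h2).ne').congr_deriv ?_
  have e1 : q t = √(q t) ^ 2 := (Real.sq_sqrt hq0.le).symm
  have e2 : r t = √(r t) ^ 2 := (Real.sq_sqrt hr0.le).symm
  simp only [Pi.mul_apply]
  generalize √(q t) = u at *
  generalize √(r t) = v at *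
  rw [e1, e2]
  field_simp

/-! ### Dihedral angles as functions of the lengths, the sine law and the derivatives -/

namespace Geometry

/-- The cosine of the angle between the gradients of the distances to two faces. -/
noncomputable def faceCos (g : Geometry) (x : Edge → ℝ) (a b : Fin 4) : ℝ :=
  g.faceGram x a b / (√(g.faceGram x a a) * √(g.faceGram x b b))

/-- The dihedral angle between the faces opposite to two vertices, in terms of the lengths. -/
noncomputable def faceAngle (g : Geometry) (x : Edge → ℝ) (a b : Fin 4) : ℝ :=
  Real.arccos (-g.faceCos x a b)

theorem faceCos_comm (g : Geometry) (x : Edge → ℝ) (a b : Fin 4) :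
    g.faceCos x a b = g.faceCos x b a := by
  rw [faceCos, faceCos, faceGram_comm, mul_comm]

theorem faceAngle_comm (g : Geometry) (x : Edge → ℝ) (a b : Fin 4) :
    g.faceAngle x a b = g.faceAngle x b a := by
  rw [faceAngle, faceAngle, faceCos_comm]

/-- The common value of `P` at pairs of opposite edges. -/
noncomputable def oppositeP (g : Geometry) (x : Edge → ℝ) : ℝ :=
  √(g.sign * (g.borderedGram x).det) * (√(g.faceGram x 0 0) * √(g.faceGram x 1 1) *
    √(g.faceGram x 2 2) * √(g.faceGram x 3 3))

/-- The product runs over all four faces, so every labelling of the vertices gives the same value.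
-/
theorem oppositeP_eq (g : Geometry) (x : Edge → ℝ) {i j k l : Fin 4} (h : [i, j, k, l].Nodup) :
    g.oppositeP x = √(g.sign * (g.borderedGram x).det) * (√(g.faceGram x i i) *
      √(g.faceGram x j j) * √(g.faceGram x k k) * √(g.faceGram x l l)) := by
  have key : ∀ i j k l : Fin 4, [i, j, k, l].Nodup →
      (Finset.univ : Finset (Fin 4)) = {i, j, k, l} := by decide
  have h1 : ∏ a, √(g.faceGram x a a) = √(g.faceGram x i i) *
      √(g.faceGram x j j) * √(g.faceGram x k k) * √(g.faceGram x l l) := by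
    rw [key i j k l h]
    simp only [List.nodup_cons, List.mem_cons, List.not_mem_nil, or_false, not_or] at h
    rw [Finset.prod_insert (by simp; tauto), Finset.prod_insert (by simp; tauto),
      Finset.prod_pair (by tauto), mul_assoc, mul_assoc]
  rw [← h1, Fin.prod_univ_four]
  rfl

namespace Admissible

variable {g : Geometry} {x : Edge → ℝ}

theorem faceCos_self (hx : g.Admissible x) (a : Fin 4) : g.faceCos x a a = 1 := by
  rw [faceCos, Real.mul_self_sqrt (hx.faceGram_self_pos a).le,
    div_self (hx.faceGram_self_pos a).ne']

theorem faceGram_eq (hx : g.Admissible x) (a b : Fin 4) :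
    g.faceGram x a b = g.faceCos x a b * (√(g.faceGram x a a) * √(g.faceGram x b b)) := by
  have h1 := Real.sqrt_pos.2 (hx.faceGram_self_pos a)
  have h2 := Real.sqrt_pos.2 (hx.faceGram_self_pos b)
  rw [faceCos, div_mul_cancel₀ _ (by positivity)]

theorem one_sub_faceCos_sq (hx : g.Admissible x) (a b : Fin 4) :
    1 - g.faceCos x a b ^ 2 = (g.faceGram x a a * g.faceGram x b b - g.faceGram x a b ^ 2) /
      (√(g.faceGram x a a) * √(g.faceGram x b b)) ^ 2 := by
  have h1 := hx.faceGram_self_pos a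
  have h2 := hx.faceGram_self_pos b
  rw [faceCos, div_pow, mul_pow, Real.sq_sqrt h1.le, Real.sq_sqrt h2.le]
  field_simp

theorem one_sub_faceCos_sq_pos (hx : g.Admissible x) {a b : Fin 4} (hab : a ≠ b) :
    0 < 1 - g.faceCos x a b ^ 2 := by
  have h1 := Real.sqrt_pos.2 (hx.faceGram_self_pos a)
  have h2 := Real.sqrt_pos.2 (hx.faceGram_self_pos b)
  rw [hx.one_sub_faceCos_sq]
  have := hx.faceGram_minor_pos hab
  positivity

theorem abs_faceCos_lt_one (hx : g.Admissible x) {a b : Fin 4} (hab : a ≠ b) :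
    -1 < g.faceCos x a b ∧ g.faceCos x a b < 1 :=
  abs_lt.1 ((sq_lt_one_iff_abs_lt_one _).1 (by linarith [hx.one_sub_faceCos_sq_pos hab]))

theorem cos_faceAngle (hx : g.Admissible x) {a b : Fin 4} (hab : a ≠ b) :
    Real.cos (g.faceAngle x a b) = -g.faceCos x a b := by
  have := hx.abs_faceCos_lt_one hab
  rw [faceAngle, Real.cos_arccos (by linarith) (by linarith)]

theorem sin_faceAngle (x : Edge → ℝ) (a b : Fin 4) :
    Real.sin (g.faceAngle x a b) = √(1 - g.faceCos x a b ^ 2) := by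
  rw [faceAngle, Real.sin_arccos, neg_sq]

theorem sin_faceAngle_pos (hx : g.Admissible x) {a b : Fin 4} (hab : a ≠ b) :
    0 < Real.sin (g.faceAngle x a b) := by
  rw [sin_faceAngle]
  exact Real.sqrt_pos.2 (hx.one_sub_faceCos_sq_pos hab)

theorem sin_faceAngle_sq (hx : g.Admissible x) {a b : Fin 4} (hab : a ≠ b) :
    Real.sin (g.faceAngle x a b) ^ 2 = 1 - g.faceCos x a b ^ 2 := by
  rw [sin_faceAngle, Real.sq_sqrt (hx.one_sub_faceCos_sq_pos hab).le]

theorem sign_mul_det_mul (hx : g.Admissible x) {i j k l : Fin 4}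
    (h : [i, j, k, l].Nodup) (hkl : k ≠ l) :
    g.sign * (g.borderedGram x).det *
      (g.faceGram x i i * g.faceGram x j j - g.faceGram x i j ^ 2) =
      g.gramFunDeriv (x (edge hkl)) ^ 2 := by
  rw [mul_assoc, hx.det_mul_faceGram_minor h hkl]
  cases g <;> simp [sign]

/-- The sine law relating a length to the dihedral angle at this edge. -/
theorem oppositeP_mul_sin (hx : g.Admissible x) {i j k l : Fin 4}
    (h : [i, j, k, l].Nodup) (hkl : k ≠ l) :
    g.oppositeP x * Real.sin (g.faceAngle x i j) =
      -g.gramFunDeriv (x (edge hkl)) * (√(g.faceGram x k k) * √(g.faceGram x l l)) := by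
  have hij : i ≠ j := by simp at h; tauto
  have h1 := Real.sqrt_pos.2 (hx.faceGram_self_pos i)
  have h2 := Real.sqrt_pos.2 (hx.faceGram_self_pos j)
  have hm := hx.faceGram_minor_pos hij
  have hneg := hx.deriv_neg (edge hkl)
  have key : √(g.sign * (g.borderedGram x).det) *
      √(g.faceGram x i i * g.faceGram x j j - g.faceGram x i j ^ 2) =
      -g.gramFunDeriv (x (edge hkl)) := by
    rw [← Real.sqrt_mul' _ hm.le, hx.sign_mul_det_mul h hkl, Real.sqrt_sq_eq_abs,
      abs_of_neg hneg]
  rw [← key, sin_faceAngle, hx.one_sub_faceCos_sq, Real.sqrt_div hm.le,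
    Real.sqrt_sq (by positivity), g.oppositeP_eq x h]
  field_simp

theorem differentiableAt_faceGram (hx : g.Admissible x) (a b : Fin 4) :
    DifferentiableAt ℝ (fun y => g.faceGram y a b) x := by
  refine Matrix.differentiableAt_inv_apply (fun c d => ?_) hx.det_ne_zero _ _
  rcases c with _ | c <;> rcases d with _ | d
  · simp
  · simp
  · simp
  · exact g.differentiable_vertexGram c d x

theorem differentiableAt_faceAngle (hx : g.Admissible x) {a b : Fin 4} (hab : a ≠ b) :
    DifferentiableAt ℝ (fun y => g.faceAngle y a b) x := by
  have h1 := hx.faceGram_self_pos a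
  have h2 := hx.faceGram_self_pos b
  have h3 := Real.sqrt_pos.2 h1
  have h4 := Real.sqrt_pos.2 h2
  have h5 := hx.abs_faceCos_lt_one hab
  have hd : DifferentiableAt ℝ (fun y => √(g.faceGram y a a) * √(g.faceGram y b b)) x :=
    ((hx.differentiableAt_faceGram a a).sqrt h1.ne').mul
      ((hx.differentiableAt_faceGram b b).sqrt h2.ne')
  have hu : DifferentiableAt ℝ (fun y => g.faceCos y a b) x := by
    simp only [faceCos, div_eq_mul_inv]
    exact (hx.differentiableAt_faceGram a b).mul (hd.inv (mul_pos h3 h4).ne')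
  exact (Real.differentiableAt_arccos.2 ⟨by linarith, by linarith⟩).comp x hu.neg

/-- dN = -N dM N, where dM is supported at the entries (r, s) and (s, r). -/
theorem hasDerivAt_faceGram (hx : g.Admissible x) {r s : Fin 4} (hrs : r ≠ s) (a b : Fin 4) :
    HasDerivAt (fun t => g.faceGram (Function.update x (edge hrs) t) a b)
      (-g.gramFunDeriv (x (edge hrs)) * (g.faceGram x a r * g.faceGram x b s +
        g.faceGram x a s * g.faceGram x b r)) (x (edge hrs)) := by
  set m := g.gramFunDeriv (x (edge hrs)) with hm
  have hM : ∀ c d, HasDerivAt (fun t => g.borderedGram (Function.update x (edge hrs) t) c d)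
      ((Matrix.single (some r) (some s) m + Matrix.single (some s) (some r) m) c d)
      (x (edge hrs)) := by
    intro c d
    rcases c with _ | c
    · rcases d with _ | d
      · simpa using hasDerivAt_const _ _
      · simpa using hasDerivAt_const _ _
    rcases d with _ | d
    · simpa using hasDerivAt_const _ _
    simp only [borderedGram_some_some, Matrix.add_apply, Matrix.single_apply, Option.some_inj]
    by_cases hcd : c = d
    · subst hcd
      rw [if_neg (by rintro ⟨rfl, rfl⟩; exact hrs rfl),
        if_neg (by rintro ⟨rfl, rfl⟩; exact hrs rfl)]
      simpa [vertexGram_self] using hasDerivAt_const _ _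
    simp only [vertexGram_of_ne _ _ hcd]
    by_cases he : edge hcd = edge hrs
    · simp only [he, Function.update_self]
      refine (g.hasDerivAt_gramFun _).congr_deriv ?_
      rcases edge_inj.1 he with ⟨rfl, rfl⟩ | ⟨rfl, rfl⟩
      · simp [hm, hcd, Ne.symm hcd]
      · simp [hm, hcd, Ne.symm hcd]
    · simp only [Function.update_of_ne he]
      have he' := fun h => he (edge_inj.2 h)
      rw [if_neg (by rintro ⟨rfl, rfl⟩; simp at he'),
        if_neg (by rintro ⟨rfl, rfl⟩; simp at he')]
      simpa using hasDerivAt_const _ _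
  have hdet : (g.borderedGram (Function.update x (edge hrs) (x (edge hrs)))).det ≠ 0 := by
    rw [Function.update_eq_self]; exact hx.det_ne_zero
  have := Matrix.hasDerivAt_inv_apply hM hdet (some a) (some b)
  rw [Function.update_eq_self] at this
  refine this.congr_deriv ?_
  have hmul : ∀ (N : Matrix (Option (Fin 4)) (Option (Fin 4)) ℝ) p q,
      (N * Matrix.single p q m * N) (some a) (some b) = m * (N (some a) p * N q (some b)) := by
    intro N p q
    rw [Matrix.mul_assoc, Matrix.mul_apply, Finset.sum_eq_single p]
    · rw [Matrix.single_mul_apply_same]; ring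
    · intro c _ hc
      rw [Matrix.single_mul_apply_of_ne _ _ _ _ _ hc, mul_zero]
    · simp
  rw [Matrix.mul_add, Matrix.add_mul, Matrix.add_apply, hmul, hmul, faceGram_comm g x b s,
    faceGram_comm g x b r]
  simp only [faceGram]
  ring

/-- Chain rule for the normalized entry N_kl; the term with the factor u_kl comes from the
normalizing entries N_kk and N_ll. -/
theorem hasDerivAt_faceAngle (hx : g.Admissible x) {r s k l : Fin 4} (hrs : r ≠ s)
    (hkl : k ≠ l) :
    HasDerivAt (fun t => g.faceAngle (Function.update x (edge hrs) t) k l)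
      (-g.gramFunDeriv (x (edge hrs)) * (√(g.faceGram x r r) * √(g.faceGram x s s)) *
        (g.faceCos x k r * g.faceCos x l s + g.faceCos x k s * g.faceCos x l r -
          g.faceCos x k l * (g.faceCos x k r * g.faceCos x k s +
            g.faceCos x l r * g.faceCos x l s)) / Real.sin (g.faceAngle x k l))
      (x (edge hrs)) := by
  have hk := hx.faceGram_self_pos k
  have hl := hx.faceGram_self_pos l
  have h3 := Real.sqrt_pos.2 hk
  have h4 := Real.sqrt_pos.2 hl
  have h5 := hx.abs_faceCos_lt_one hkl
  have hu := (hx.hasDerivAt_faceGram hrs k l).div_sqrt_mul_sqrt (hx.hasDerivAt_faceGram hrs k k)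
    (hx.hasDerivAt_faceGram hrs l l) (by rwa [Function.update_eq_self])
    (by rwa [Function.update_eq_self])
  have ha := Real.hasDerivAt_arccos (x := -g.faceCos x k l) (by linarith) (by linarith)
  have hx' : x = Function.update x (edge hrs) (x (edge hrs)) := (Function.update_eq_self _ _).symm
  have hcomp := HasDerivAt.comp (h₂ := Real.arccos)
    (h := fun t => -g.faceCos (Function.update x (edge hrs) t) k l) (x (edge hrs))
    (by rw [← hx']; exact ha) hu.neg
  refine hcomp.congr_deriv ?_
  rw [← hx', neg_sq, ← sin_faceAngle]
  have hs := hx.sin_faceAngle_pos hkl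
  generalize Real.sin (g.faceAngle x k l) = σ at *
  generalize g.gramFunDeriv (x (edge hrs)) = m
  rw [hx.faceGram_eq k r, hx.faceGram_eq k s, hx.faceGram_eq l r, hx.faceGram_eq l s,
    hx.faceGram_eq k l]
  have e1 : g.faceGram x k k = √(g.faceGram x k k) ^ 2 := (Real.sq_sqrt hk.le).symm
  have e2 : g.faceGram x l l = √(g.faceGram x l l) ^ 2 := (Real.sq_sqrt hl.le).symm
  generalize √(g.faceGram x k k) = u at *
  generalize √(g.faceGram x l l) = v at *
  rw [e1, e2]
  field_simp
  ring

/-- The quantity `P` at the pair of edges `v_i v_j` and `v_r v_s`. -/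
theorem deriv_faceAngle_div (hx : g.Admissible x) {k l r s p q : Fin 4} (hkl : k ≠ l)
    (h : [p, q, r, s].Nodup) (hrs : r ≠ s) :
    1 / (Real.sin (g.faceAngle x k l) * Real.sin (g.faceAngle x p q)) *
      deriv (fun t => g.faceAngle (Function.update x (edge hrs) t) k l) (x (edge hrs)) =
    g.oppositeP x * ((g.faceCos x k r * g.faceCos x l s + g.faceCos x k s * g.faceCos x l r -
          g.faceCos x k l * (g.faceCos x k r * g.faceCos x k s +
            g.faceCos x l r * g.faceCos x l s)) / Real.sin (g.faceAngle x k l) ^ 2) := by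
  have hpq : p ≠ q := by simp at h; tauto
  have h1 := hx.sin_faceAngle_pos hkl
  have h2 := hx.sin_faceAngle_pos hpq
  -- The sine law replaces the only factor depending on the geometry by P₀ times the sine at v_r
  -- v_s, which cancels.
  rw [(hx.hasDerivAt_faceAngle hrs hkl).deriv, ← hx.oppositeP_mul_sin h hrs]
  field_simp

end Admissible

end Geometry

/-! ### Tetrahedra and their Gram matrices -/

section Form

variable {V : Type} [AddCommGroup V] [Module ℝ V]

/-- The half-plane angle in terms of the inverse Gram matrix. -/
theorem halfPlaneAngle_eq_arccos {B : LinearMap.BilinForm ℝ V} (hB : ∀ u w, B u w = B w u)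
    {d a b : V} {δ K L M : ℝ} (hd : 0 < B d d) (hδ : 0 < δ)
    (hK : K = (B d d * B b b - B d b ^ 2) * δ) (hL : L = (B d d * B a a - B d a ^ 2) * δ)
    (hM : M = -(B d d * B a b - B d a * B d b) * δ) :
    halfPlaneAngle (fun u w => B u w) d a b = Real.arccos (-(M / (√K * √L))) := by
  have h0 : 0 < B d d * δ := mul_pos hd hδ
  have h : ∀ u w, B (orthComponent (fun u w => B u w) d u) (orthComponent (fun u w => B u w) d w) =
      (B d d * B u w - B d u * B d w) / B d d := by
    intro u w
    simp only [orthComponent, map_sub, map_smul, LinearMap.sub_apply, LinearMap.smul_apply,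
      smul_eq_mul, hB u d, hB w d]
    field_simp
    ring
  have haa : (B d d * B a a - B d a * B d a) / B d d = L / (B d d * δ) := by
    rw [hL]; field_simp
  have hbb : (B d d * B b b - B d b * B d b) / B d d = K / (B d d * δ) := by
    rw [hK]; field_simp
  have hab : (B d d * B a b - B d a * B d b) / B d d = -M / (B d d * δ) := by
    rw [hM]; field_simp
  rw [halfPlaneAngle, formAngle, h, h, h, haa, hbb, hab, Real.sqrt_div' _ h0.le,
    Real.sqrt_div' _ h0.le, div_mul_div_comm, Real.mul_self_sqrt h0.le,
    div_div_div_cancel_right₀ h0.ne', neg_div, mul_comm √L]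

theorem posMinors_of_form_pos {B : LinearMap.BilinForm ℝ V} (hB : ∀ u w, B u w = B w u)
    {a b c : V} (h : ∀ p q r : ℝ, ¬(p = 0 ∧ q = 0 ∧ r = 0) →
      0 < B (p • a + q • b + r • c) (p • a + q • b + r • c)) :
    PosMinors (B a a) (B b b) (B c c) (B a b) (B a c) (B b c) := by
  refine posMinors_of_pos fun p q r hpqr => ?_
  refine (h p q r hpqr).trans_eq ?_
  simp only [map_add, map_smul, LinearMap.add_apply, LinearMap.smul_apply, smul_eq_mul,
    hB b a, hB c a, hB c b]
  ring

/-- The coefficient `c` of the base vertex is left free because projecting away from v_i changes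
only this coefficient. -/
theorem LinearIndependent.eq_zero_of_nodup {v : Fin 4 → V} (hv : LinearIndependent ℝ v)
    {i j k l : Fin 4} (h : [i, j, k, l].Nodup) {c p q r : ℝ}
    (h0 : c • v i + p • v j + q • v k + r • v l = 0) : p = 0 ∧ q = 0 ∧ r = 0 := by
  have hn := h
  simp only [List.nodup_cons, List.mem_cons, List.not_mem_nil, or_false, not_or,
    not_false_eq_true] at h
  obtain ⟨⟨hij, hik, hil⟩, ⟨hjk, hjl⟩, hkl, -⟩ := h
  let f : Fin 4 → ℝ := fun a => if a = i then c else if a = j then p else if a = k then q else r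
  have hf := Fintype.linearIndependent_iff.1 hv f (by
    rw [sum_fin_four_of_nodup hn]
    simpa [f, Ne.symm hij, Ne.symm hik, Ne.symm hil, Ne.symm hjk, Ne.symm hjl, Ne.symm hkl]
      using h0)
  have h1 := hf j
  have h2 := hf k
  have h3 := hf l
  simp only [f, Ne.symm hij, Ne.symm hik, Ne.symm hil, Ne.symm hjk, Ne.symm hjl, Ne.symm hkl,
    if_true, if_false] at h1 h2 h3
  exact ⟨h1, h2, h3⟩

theorem AffineIndependent.eq_zero_of_nodup {v : Fin 4 → V} (hv : AffineIndependent ℝ v)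
    {i j k l : Fin 4} (h : [i, j, k, l].Nodup) {p q r : ℝ}
    (h0 : p • (v j - v i) + q • (v k - v i) + r • (v l - v i) = 0) :
    p = 0 ∧ q = 0 ∧ r = 0 := by
  have hn := h
  simp only [List.nodup_cons, List.mem_cons, List.not_mem_nil, or_false, not_or,
    not_false_eq_true] at h
  obtain ⟨⟨hij, hik, hil⟩, ⟨hjk, hjl⟩, hkl, -⟩ := h
  let f : Fin 4 → ℝ := fun a =>
    if a = i then -(p + q + r) else if a = j then p else if a = k then q else r
  have fi : f i = -(p + q + r) := by simp [f]
  have fj : f j = p := by simp [f, Ne.symm hij]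
  have fk : f k = q := by simp [f, Ne.symm hik, Ne.symm hjk]
  have fl : f l = r := by simp [f, Ne.symm hil, Ne.symm hjl, Ne.symm hkl]
  have hf := affineIndependent_iff.1 hv Finset.univ f
    (by rw [sum_fin_four_of_nodup hn f, fi, fj, fk, fl]; ring)
    (by rw [sum_fin_four_of_nodup hn fun a => f a • v a, fi, fj, fk, fl, ← h0]; module)
  exact ⟨fj ▸ hf j (Finset.mem_univ _), fk ▸ hf k (Finset.mem_univ _),
    fl ▸ hf l (Finset.mem_univ _)⟩

end Form

/-- The Lorentz form as a bilinear form. -/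
noncomputable def lorentzForm : LinearMap.BilinForm ℝ (Fin 4 → ℝ) :=
  LinearMap.mk₂ ℝ lorentz (fun _ _ _ => by simp [lorentz]; ring)
    (fun _ _ _ => by simp [lorentz]; ring) (fun _ _ _ => by simp [lorentz]; ring)
    (fun _ _ _ => by simp [lorentz]; ring)

theorem lorentzForm_apply (u w : Fin 4 → ℝ) : lorentzForm u w = lorentz u w := rfl

theorem lorentz_comm (u w : Fin 4 → ℝ) : lorentz u w = lorentz w u := by
  simp only [lorentz]; ring

theorem sq_dot_le (a b c p q r : ℝ) :
    (a * p + b * q + c * r) ^ 2 ≤ (a ^ 2 + b ^ 2 + c ^ 2) * (p ^ 2 + q ^ 2 + r ^ 2) := by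
  nlinarith [sq_nonneg (a * q - b * p), sq_nonneg (a * r - c * p), sq_nonneg (b * r - c * q)]

/-- Vectors orthogonal to a timelike vector are spacelike. -/
theorem lorentz_pos_of_orthogonal {u y : Fin 4 → ℝ} (hu : lorentz u u = -1)
    (hy : lorentz y u = 0) (h0 : y ≠ 0) : 0 < lorentz y y := by
  have hcs := sq_dot_le (y 1) (y 2) (y 3) (u 1) (u 2) (u 3)
  simp only [lorentz] at hu hy ⊢
  have h1 : y 1 * u 1 + y 2 * u 2 + y 3 * u 3 = y 0 * u 0 := by linarith
  have h2 : u 0 ^ 2 = 1 + (u 1 ^ 2 + u 2 ^ 2 + u 3 ^ 2) := by linarith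
  rw [h1, mul_pow, h2] at hcs
  by_contra hneg
  have h3 : y 1 ^ 2 + y 2 ^ 2 + y 3 ^ 2 ≤ y 0 ^ 2 := by linarith
  have hU : 0 ≤ u 1 ^ 2 + u 2 ^ 2 + u 3 ^ 2 := by positivity
  -- With U the spatial square of u, Cauchy–Schwarz gives y₀² (1 + U) ≤ y₀² U.
  have h4 : y 0 ^ 2 ≤ 0 := by nlinarith
  have h5 : y 1 ^ 2 + y 2 ^ 2 + y 3 ^ 2 ≤ 0 := h3.trans h4
  have h6 : y 0 = 0 := by nlinarith
  have h7 : y 1 = 0 := by nlinarith [sq_nonneg (y 1), sq_nonneg (y 2), sq_nonneg (y 3)]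
  have h8 : y 2 = 0 := by nlinarith [sq_nonneg (y 1), sq_nonneg (y 2), sq_nonneg (y 3)]
  have h9 : y 3 = 0 := by nlinarith [sq_nonneg (y 1), sq_nonneg (y 2), sq_nonneg (y 3)]
  apply h0
  funext a
  fin_cases a
  exacts [h6, h7, h8, h9]

/-- The reversed Cauchy–Schwarz inequality. -/
theorem one_le_neg_lorentz {u w : Fin 4 → ℝ} (hu : lorentz u u = -1) (hw : lorentz w w = -1)
    (hu0 : 0 < u 0) (hw0 : 0 < w 0) : 1 ≤ -lorentz u w := by
  have hcs := sq_dot_le (u 1) (u 2) (u 3) (w 1) (w 2) (w 3)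
  simp only [lorentz] at *
  set U := u 1 ^ 2 + u 2 ^ 2 + u 3 ^ 2 with hU
  set W := w 1 ^ 2 + w 2 ^ 2 + w 3 ^ 2 with hW
  have h1 : u 0 ^ 2 = 1 + U := by linarith
  have h2 : w 0 ^ 2 = 1 + W := by linarith
  have hle : u 1 * w 1 + u 2 * w 2 + u 3 * w 3 ≤ u 0 * w 0 - 1 := by
    have hU0 : 0 ≤ U := by positivity
    have hW0 : 0 ≤ W := by positivity
    have huw : 1 ≤ u 0 * w 0 := by
      have : (1 : ℝ) ^ 2 ≤ (u 0 * w 0) ^ 2 := by rw [mul_pow, h1, h2]; nlinarith [mul_nonneg hU0 hW0]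
      exact (sq_le_sq₀ zero_le_one (by positivity)).1 this
    refine (abs_le.1 (abs_le_of_sq_le_sq (b := u 0 * w 0 - 1) (hcs.trans ?_) (by linarith))).2
    -- By the inequality of means 2 u₀ w₀ ≤ 2 + U + W, which is equivalent to U W ≤ (u₀ w₀ - 1)².
    have h3 : (2 * (u 0 * w 0)) ^ 2 ≤ (2 + U + W) ^ 2 := by
      have : (2 * (u 0 * w 0)) ^ 2 = 4 * (1 + U) * (1 + W) := by rw [← h1, ← h2]; ring
      nlinarith [sq_nonneg (U - W)]
    have h4 := (sq_le_sq₀ (by positivity) (by positivity)).1 h3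
    have h5 : (u 0 * w 0) ^ 2 = (1 + U) * (1 + W) := by rw [mul_pow, h1, h2]
    nlinarith
  linarith

/-! ### The range of the edge lengths -/

namespace Geometry

/-- The lengths allowed for the edges. -/
def lengthRange : Geometry → Set ℝ
  | spherical => Set.Ioo 0 Real.pi
  | hyperbolic => Set.Ioi 0
  | euclidean => Set.Ioi 0

theorem isOpen_lengthRange (g : Geometry) : IsOpen g.lengthRange := by
  cases g
  exacts [isOpen_Ioo, isOpen_Ioi, isOpen_Ioi]

theorem tangentGram_self_eq_sq (g : Geometry) (x : Edge → ℝ) {i j : Fin 4} (h : j ≠ i) :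
    g.tangentGram x i j j = g.gramFunDeriv (x (edge h)) ^ 2 := by
  cases g <;> simp only [tangentGram, vertexGram_self, vertexGram_of_ne _ _ h, gramFun,
    gramFunDeriv, Real.cos_zero, Real.cosh_zero]
  · linear_combination -Real.sin_sq_add_cos_sq (x (edge h))
  · linear_combination Real.cosh_sq (x (edge h))
  · ring

/-- On the closed range of lengths the derivative vanishes only at 0 and, on the sphere, at π. Its
nonvanishing will come from positivity of `tangentGram_self_eq_sq`. -/
theorem gramFunDeriv_neg_iff {g : Geometry} {t : ℝ} (h0 : 0 ≤ t)
    (hpi : g = spherical → t ≤ Real.pi) (h : g.gramFunDeriv t ≠ 0) :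
    g.gramFunDeriv t < 0 ∧ t ∈ g.lengthRange := by
  have ht : t ≠ 0 := by
    rintro rfl
    cases g <;> simp [gramFunDeriv] at h
  have ht0 : 0 < t := lt_of_le_of_ne h0 ht.symm
  cases g
  · have : t ≠ Real.pi := by
      rintro rfl
      simp [gramFunDeriv] at h
    have hlt := lt_of_le_of_ne (hpi rfl) this
    exact ⟨neg_neg_of_pos (Real.sin_pos_of_pos_of_lt_pi ht0 hlt), ht0, hlt⟩
  · exact ⟨neg_neg_of_pos (Real.sinh_pos_iff.2 ht0), ht0⟩
  · exact ⟨neg_neg_of_pos ht0, ht0⟩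

end Geometry

namespace Tetrahedron

open Geometry

variable {g : Geometry} (T : Tetrahedron g)

theorem length_comm (i j : Fin 4) : T.length i j = T.length j i := by
  cases g
  · exact InnerProductGeometry.angle_comm _ _
  · exact congrArg (fun t => Real.arcosh (-t)) (lorentz_comm _ _)
  · exact dist_comm _ _

theorem lengths_edge {i j : Fin 4} (h : i ≠ j) : T.lengths (edge h) = T.length i j :=
  edge_ends T.length T.length_comm h

theorem length_nonneg (i j : Fin 4) : 0 ≤ T.length i j := by
  cases g
  · exact InnerProductGeometry.angle_nonneg _ _
  · exact Real.arcosh_nonneg (one_le_neg_lorentz (T.lorentz_self i) (T.lorentz_self j)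
      (T.pos i) (T.pos j))
  · exact dist_nonneg

end Tetrahedron

open Geometry

theorem real_innerₗ_comm {E : Type*} [NormedAddCommGroup E] [InnerProductSpace ℝ E] (u w : E) :
    innerₗ E u w = innerₗ E w u := real_inner_comm _ _

/-! ### Gram matrices and dihedral angles in each geometry -/

namespace SphericalTetrahedron

variable (T : SphericalTetrahedron) {x : Edge → ℝ}

theorem inner_vertex (hx : ∀ {i j : Fin 4} (h : i ≠ j), x (edge h) = T.length i j)
    (i j : Fin 4) :
    inner ℝ (T.vertex i) (T.vertex j) = spherical.vertexGram x i j := by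
  by_cases h : i = j
  · subst h
    rw [vertexGram_self, real_inner_self_eq_norm_sq, T.norm_eq_one]
    simp [gramFun]
  · rw [vertexGram_of_ne _ _ h, hx]
    change _ = Real.cos (InnerProductGeometry.angle _ _)
    rw [InnerProductGeometry.cos_angle, T.norm_eq_one, T.norm_eq_one, mul_one, div_one]

theorem inner_dir (hx : ∀ {i j : Fin 4} (h : i ≠ j), x (edge h) = T.length i j)
    (i a b : Fin 4) :
    innerₗ (EuclideanSpace ℝ (Fin 4))
      (orthComponent (fun x y => inner ℝ x y) (T.vertex i) (T.vertex a))
      (orthComponent (fun x y => inner ℝ x y) (T.vertex i) (T.vertex b)) =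
      spherical.tangentGram x i a b := by
  rw [innerₗ_apply_apply]
  simp only [orthComponent, inner_sub_left, inner_sub_right, real_inner_smul_left,
    real_inner_smul_right, T.inner_vertex hx, tangentGram, vertexGram_self, gramFun,
    Real.cos_zero, vertexGram_comm _ _ i b]
  ring

theorem tangentPos (hx : ∀ {i j : Fin 4} (h : i ≠ j), x (edge h) = T.length i j)
    {i j k l : Fin 4} (h : [i, j, k, l].Nodup) :
    spherical.TangentPos x i j k l := by
  simp only [TangentPos, ← T.inner_dir hx]
  refine posMinors_of_form_pos real_innerₗ_comm fun p q r hpqr => ?_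
  rw [innerₗ_apply_apply, real_inner_self_pos]
  refine fun h0 => hpqr (T.linearIndependent.eq_zero_of_nodup h
    -- The total multiple of v_i subtracted by the three projections.
    (c := -(p * (inner ℝ (T.vertex j) (T.vertex i) / inner ℝ (T.vertex i) (T.vertex i)) +
      q * (inner ℝ (T.vertex k) (T.vertex i) / inner ℝ (T.vertex i) (T.vertex i)) +
      r * (inner ℝ (T.vertex l) (T.vertex i) / inner ℝ (T.vertex i) (T.vertex i)))) ?_)
  rw [← h0]
  simp only [orthComponent]
  module

theorem dihedral_eq_faceAngle
    (hx : ∀ {i j : Fin 4} (h : i ≠ j), x (edge h) = T.length i j)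
    (hadm : spherical.Admissible x) {i j k l : Fin 4}
    (h : [i, j, k, l].Nodup) : T.dihedral i j k l = spherical.faceAngle x k l := by
  obtain ⟨δ, hδ, hk, hl, hkl, -⟩ := hadm.exists_faceGram_eq h
  have hj := (hadm.tangentPos h).1
  simp only [← T.inner_dir hx] at hk hl hkl hj
  exact halfPlaneAngle_eq_arccos real_innerₗ_comm hj hδ hk hl hkl

end SphericalTetrahedron

namespace HyperbolicTetrahedron

variable (T : HyperbolicTetrahedron) {x : Edge → ℝ}

theorem lorentz_vertex (hx : ∀ {i j : Fin 4} (h : i ≠ j), x (edge h) = T.length i j)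
    (i j : Fin 4) :
    lorentz (T.vertex i) (T.vertex j) = hyperbolic.vertexGram x i j := by
  by_cases h : i = j
  · subst h
    rw [vertexGram_self, T.lorentz_self]
    simp [gramFun]
  · rw [vertexGram_of_ne _ _ h, hx]
    change _ = -Real.cosh (Real.arcosh (-lorentz (T.vertex i) (T.vertex j)))
    rw [Real.cosh_arcosh (one_le_neg_lorentz (T.lorentz_self i) (T.lorentz_self j)
      (T.pos i) (T.pos j)), neg_neg]

theorem lorentz_dir (hx : ∀ {i j : Fin 4} (h : i ≠ j), x (edge h) = T.length i j)
    (i a b : Fin 4) :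
    lorentzForm (orthComponent lorentz (T.vertex i) (T.vertex a))
      (orthComponent lorentz (T.vertex i) (T.vertex b)) = hyperbolic.tangentGram x i a b := by
  simp only [orthComponent, map_sub, map_smul, LinearMap.sub_apply, LinearMap.smul_apply,
    smul_eq_mul, lorentzForm_apply, T.lorentz_vertex hx, tangentGram, vertexGram_self, gramFun,
    Real.cosh_zero, vertexGram_comm _ _ i b]
  ring

/-- The tangent vectors lie in the Lorentz complement of a timelike vector, where the form is
positive definite, and they are independent because the vertices are. -/
theorem tangentPos (hx : ∀ {i j : Fin 4} (h : i ≠ j), x (edge h) = T.length i j)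
    {i j k l : Fin 4} (h : [i, j, k, l].Nodup) :
    hyperbolic.TangentPos x i j k l := by
  simp only [TangentPos, ← T.lorentz_dir hx]
  refine posMinors_of_form_pos (B := lorentzForm) lorentz_comm fun p q r hpqr => ?_
  refine lorentz_pos_of_orthogonal (T.lorentz_self i) ?_ fun h0 =>
    hpqr (T.linearIndependent.eq_zero_of_nodup h
      (c := -(p * (lorentz (T.vertex j) (T.vertex i) / lorentz (T.vertex i) (T.vertex i)) +
        q * (lorentz (T.vertex k) (T.vertex i) / lorentz (T.vertex i) (T.vertex i)) +
        r * (lorentz (T.vertex l) (T.vertex i) / lorentz (T.vertex i) (T.vertex i)))) ?_)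
  · have horth : ∀ a, lorentzForm (orthComponent lorentz (T.vertex i) (T.vertex a))
        (T.vertex i) = 0 := by
      intro a
      simp only [orthComponent, map_sub, map_smul, LinearMap.sub_apply, LinearMap.smul_apply,
        smul_eq_mul, lorentzForm_apply, T.lorentz_self]
      ring
    rw [← lorentzForm_apply]
    simp only [map_add, map_smul, LinearMap.add_apply, LinearMap.smul_apply, horth, smul_zero,
      add_zero]
  · rw [← h0]
    simp only [orthComponent]
    module

theorem dihedral_eq_faceAngle
    (hx : ∀ {i j : Fin 4} (h : i ≠ j), x (edge h) = T.length i j)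
    (hadm : hyperbolic.Admissible x) {i j k l : Fin 4}
    (h : [i, j, k, l].Nodup) : T.dihedral i j k l = hyperbolic.faceAngle x k l := by
  obtain ⟨δ, hδ, hk, hl, hkl, -⟩ := hadm.exists_faceGram_eq h
  have hj := (hadm.tangentPos h).1
  simp only [← T.lorentz_dir hx] at hk hl hkl hj
  exact halfPlaneAngle_eq_arccos (B := lorentzForm) lorentz_comm hj hδ hk hl hkl

end HyperbolicTetrahedron

namespace EuclideanTetrahedron

variable (T : EuclideanTetrahedron) {x : Edge → ℝ}

theorem dist_vertex (hx : ∀ {i j : Fin 4} (h : i ≠ j), x (edge h) = T.length i j)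
    (i j : Fin 4) :
    -‖T.vertex i - T.vertex j‖ ^ 2 / 2 = euclidean.vertexGram x i j := by
  by_cases h : i = j
  · subst h
    simp [vertexGram_self, gramFun]
  · rw [vertexGram_of_ne _ _ h, hx]
    change _ = -dist _ _ ^ 2 / 2
    rw [dist_eq_norm]

theorem inner_dir (hx : ∀ {i j : Fin 4} (h : i ≠ j), x (edge h) = T.length i j)
    (i a b : Fin 4) :
    innerₗ (EuclideanSpace ℝ (Fin 3)) (T.vertex a - T.vertex i) (T.vertex b - T.vertex i) =
      euclidean.tangentGram x i a b := by
  have h : T.vertex a - T.vertex b =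
      (T.vertex a - T.vertex i) - (T.vertex b - T.vertex i) := by abel
  rw [innerₗ_apply_apply]
  simp only [tangentGram, ← T.dist_vertex hx]
  rw [h, @norm_sub_sq_real]
  ring

theorem tangentPos (hx : ∀ {i j : Fin 4} (h : i ≠ j), x (edge h) = T.length i j)
    {i j k l : Fin 4} (h : [i, j, k, l].Nodup) :
    euclidean.TangentPos x i j k l := by
  simp only [TangentPos, ← T.inner_dir hx]
  refine posMinors_of_form_pos real_innerₗ_comm fun p q r hpqr => ?_
  rw [innerₗ_apply_apply, real_inner_self_pos]
  exact fun h0 => hpqr (T.affineIndependent.eq_zero_of_nodup h h0)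

theorem dihedral_eq_faceAngle
    (hx : ∀ {i j : Fin 4} (h : i ≠ j), x (edge h) = T.length i j)
    (hadm : euclidean.Admissible x) {i j k l : Fin 4}
    (h : [i, j, k, l].Nodup) : T.dihedral i j k l = euclidean.faceAngle x k l := by
  obtain ⟨δ, hδ, hk, hl, hkl, -⟩ := hadm.exists_faceGram_eq h
  have hj := (hadm.tangentPos h).1
  simp only [← T.inner_dir hx] at hk hl hkl hj
  exact halfPlaneAngle_eq_arccos real_innerₗ_comm hj hδ hk hl hkl

end EuclideanTetrahedron

namespace Tetrahedron

variable {g : Geometry} (T : Tetrahedron g)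

theorem tangentPos {i j k l : Fin 4} (h : [i, j, k, l].Nodup) :
    g.TangentPos T.lengths i j k l := by
  cases g
  · exact SphericalTetrahedron.tangentPos T T.lengths_edge h
  · exact HyperbolicTetrahedron.tangentPos T T.lengths_edge h
  · exact EuclideanTetrahedron.tangentPos T T.lengths_edge h

theorem deriv_neg_and_mem_lengthRange (e : Edge) :
    g.gramFunDeriv (T.lengths e) < 0 ∧ T.lengths e ∈ g.lengthRange := by
  obtain ⟨i, j, k, l, hij, h, rfl⟩ := e.exists_rep
  have hji : [j, i, k, l].Nodup := by simp at h ⊢; tauto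
  refine gramFunDeriv_neg_iff ?_ ?_ fun h0 => ?_
  · rw [T.lengths_edge]; exact T.length_nonneg i j
  · rintro rfl
    rw [T.lengths_edge]
    exact InnerProductGeometry.angle_le_pi _ _
  · have := (T.tangentPos hji).1
    rw [tangentGram_self_eq_sq _ _ hij, h0] at this
    simp at this

theorem admissible : g.Admissible T.lengths :=
  ⟨fun e => (T.deriv_neg_and_mem_lengthRange e).1, fun h => T.tangentPos h⟩

theorem dihedral_eq_faceAngle {i j k l : Fin 4} (h : [i, j, k, l].Nodup) :
    T.dihedral i j k l = g.faceAngle T.lengths k l := by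
  cases g
  · exact SphericalTetrahedron.dihedral_eq_faceAngle T T.lengths_edge T.admissible h
  · exact HyperbolicTetrahedron.dihedral_eq_faceAngle T T.lengths_edge T.admissible h
  · exact EuclideanTetrahedron.dihedral_eq_faceAngle T T.lengths_edge T.admissible h

end Tetrahedron

/-! ### Existence of tetrahedra with given edge lengths -/

open Geometry

/-- Back substitution, starting from the last coordinate. -/
theorem linearIndependent_of_triangular {V : Type*} [AddCommGroup V] [Module ℝ V]
    (coord : Fin 4 → V →ₗ[ℝ] ℝ) {v : Fin 4 → V} (hd : ∀ i, coord i (v i) ≠ 0)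
    (h : ∀ i j, i < j → coord j (v i) = 0) : LinearIndependent ℝ v := by
  rw [Fintype.linearIndependent_iff]
  intro c hc
  have hcoord : ∀ j, ∑ i, c i * coord j (v i) = 0 := by
    intro j
    simpa using congrArg (coord j) hc
  simp only [Fin.sum_univ_four] at hcoord
  have h3 : c 3 = 0 := by
    have := hcoord 3
    rw [h 0 3 (by decide), h 1 3 (by decide), h 2 3 (by decide)] at this
    simpa [hd 3] using this
  have h2 : c 2 = 0 := by
    have := hcoord 2
    rw [h 0 2 (by decide), h 1 2 (by decide), h3] at this
    simpa [hd 2] using this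
  have h1 : c 1 = 0 := by
    have := hcoord 1
    rw [h 0 1 (by decide), h2, h3] at this
    simpa [hd 1] using this
  have h0 : c 0 = 0 := by
    have := hcoord 0
    rw [h1, h2, h3] at this
    simpa [hd 0] using this
  intro i
  fin_cases i
  exacts [h0, h1, h2, h3]

theorem exists_sphericalTetrahedron {x : Edge → ℝ} (hx : ∀ e, x e ∈ spherical.lengthRange)
    (hpos : spherical.TangentPos x 0 1 2 3) :
    ∃ T : SphericalTetrahedron, ∀ {i j : Fin 4} (h : i ≠ j), T.length i j = x (edge h) := by
  obtain ⟨a, b, c, d, e, f, ha, hc, hf, h11, h12, h22, h13, h23, h33⟩ := hpos.exists_cholesky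
  have hdiag : ∀ i, spherical.vertexGram x i i = 1 := fun i => by
    simp [vertexGram_self, gramFun]
  simp only [tangentGram, hdiag] at h11 h12 h22 h13 h23 h33
  set G := spherical.vertexGram x with hG
  have hcomm : ∀ i j, G i j = G j i := vertexGram_comm _ _
  -- The first coordinate records the product with v_0; the other three are the Cholesky rows of the
  -- tangent Gram matrix at v_0.
  let v : Fin 4 → EuclideanSpace ℝ (Fin 4) :=
    ![!₂[1, 0, 0, 0], !₂[G 1 0, a, 0, 0], !₂[G 2 0, b, c, 0], !₂[G 3 0, d, e, f]]
  have hle : ∀ i j, i ≤ j → inner ℝ (v i) (v j) = G i j := by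
    intro i j hij
    rw [PiLp.inner_apply]
    fin_cases i <;> fin_cases j <;> simp at hij <;>
      simp [v, Fin.sum_univ_four, hdiag, hcomm 0] <;> linarith
  have hin : ∀ i j, inner ℝ (v i) (v j) = G i j := by
    intro i j
    rcases le_total i j with h | h
    · exact hle i j h
    · rw [real_inner_comm, hle j i h, hcomm]
  have hnorm : ∀ i, ‖v i‖ = 1 := by
    intro i
    have := hin i i
    rw [hdiag, real_inner_self_eq_norm_sq] at this
    exact (pow_eq_one_iff_of_nonneg (norm_nonneg _) two_ne_zero).1 this
  refine ⟨⟨v, hnorm, ?_⟩, fun {i j} h => ?_⟩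
  · refine linearIndependent_of_triangular
      (fun i => (EuclideanSpace.proj i : EuclideanSpace ℝ (Fin 4) →L[ℝ] ℝ).toLinearMap) ?_ ?_
    · intro i
      fin_cases i <;> simp [v, ha.ne', hc.ne', hf.ne']
    · intro i j hij
      fin_cases i <;> fin_cases j <;> simp at hij <;> simp [v]
  · change Real.arccos (inner ℝ (v i) (v j) / (‖v i‖ * ‖v j‖)) = _
    rw [hin, hnorm, hnorm, mul_one, div_one, hG, vertexGram_of_ne _ _ h]
    exact Real.arccos_cos (hx _).1.le (hx _).2.le

theorem exists_hyperbolicTetrahedron {x : Edge → ℝ} (hx : ∀ e, x e ∈ hyperbolic.lengthRange)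
    (hpos : hyperbolic.TangentPos x 0 1 2 3) :
    ∃ T : HyperbolicTetrahedron, ∀ {i j : Fin 4} (h : i ≠ j), T.length i j = x (edge h) := by
  obtain ⟨a, b, c, d, e, f, ha, hc, hf, h11, h12, h22, h13, h23, h33⟩ := hpos.exists_cholesky
  have hdiag : ∀ i, hyperbolic.vertexGram x i i = -1 := fun i => by
    simp [vertexGram_self, gramFun]
  have hneg : ∀ i, 0 < -hyperbolic.vertexGram x i 0 := by
    intro i
    by_cases h : i = 0
    · rw [h, hdiag]; norm_num
    · rw [vertexGram_of_ne _ _ h, gramFun, neg_neg]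
      exact Real.cosh_pos _
  simp only [tangentGram, hdiag] at h11 h12 h22 h13 h23 h33
  set G := hyperbolic.vertexGram x with hG
  have hcomm : ∀ i j, G i j = G j i := vertexGram_comm _ _
  -- As on the sphere, with the sign of the timelike coordinate reversed; these coordinates are
  -- positive, being 1 or hyperbolic cosines.
  let v : Fin 4 → (Fin 4 → ℝ) :=
    ![![1, 0, 0, 0], ![-G 1 0, a, 0, 0], ![-G 2 0, b, c, 0], ![-G 3 0, d, e, f]]
  have hle : ∀ i j, i ≤ j → lorentz (v i) (v j) = G i j := by
    intro i j hij
    fin_cases i <;> fin_cases j <;> simp at hij <;>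
      simp [v, lorentz, hdiag, hcomm 0] <;> linarith
  have hin : ∀ i j, lorentz (v i) (v j) = G i j := by
    intro i j
    rcases le_total i j with h | h
    · exact hle i j h
    · rw [lorentz_comm, hle j i h, hcomm]
  refine ⟨⟨v, fun i => by rw [hin, hdiag], ?_, ?_⟩, fun {i j} h => ?_⟩
  · intro i
    fin_cases i
    · simp [v]
    · exact hneg 1
    · exact hneg 2
    · exact hneg 3
  · refine linearIndependent_of_triangular (fun i => LinearMap.proj i) ?_ ?_
    · intro i
      fin_cases i <;> simp [v, ha.ne', hc.ne', hf.ne']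
    · intro i j hij
      fin_cases i <;> fin_cases j <;> simp at hij <;> simp [v]
  · change Real.arcosh (-lorentz (v i) (v j)) = _
    rw [hin, hG, vertexGram_of_ne _ _ h, gramFun, neg_neg]
    exact Real.arcosh_cosh (le_of_lt (hx _))

theorem exists_euclideanTetrahedron {x : Edge → ℝ} (hx : ∀ e, x e ∈ euclidean.lengthRange)
    (hpos : euclidean.TangentPos x 0 1 2 3) :
    ∃ T : EuclideanTetrahedron, ∀ {i j : Fin 4} (h : i ≠ j), T.length i j = x (edge h) := by
  obtain ⟨a, b, c, d, e, f, ha, hc, hf, h11, h12, h22, h13, h23, h33⟩ := hpos.exists_cholesky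
  have hdiag : ∀ i, euclidean.vertexGram x i i = 0 := fun i => by
    simp [vertexGram_self, gramFun]
  simp only [tangentGram, hdiag] at h11 h12 h22 h13 h23 h33
  set G := euclidean.vertexGram x with hG
  have hcomm : ∀ i j, G i j = G j i := vertexGram_comm _ _
  let v : Fin 4 → EuclideanSpace ℝ (Fin 3) := ![0, !₂[a, 0, 0], !₂[b, c, 0], !₂[d, e, f]]
  have hle : ∀ i j, i ≤ j → ‖v i - v j‖ ^ 2 = -2 * G i j := by
    intro i j hij
    rw [EuclideanSpace.norm_sq_eq]
    fin_cases i <;> fin_cases j <;> simp at hij <;>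
      simp [v, Fin.sum_univ_three, hdiag, hcomm 0] <;> linarith
  have hin : ∀ i j, ‖v i - v j‖ ^ 2 = -2 * G i j := by
    intro i j
    rcases le_total i j with h | h
    · exact hle i j h
    · rw [norm_sub_rev, hle j i h, hcomm]
  refine ⟨⟨v, ?_⟩, fun {i j} h => ?_⟩
  · rw [affineIndependent_iff]
    intro s w hw hw0
    -- Affine independence of the v_i is linear independence of the lifted vectors (1, v_i), which
    -- are triangular.
    refine linearIndependent_iff'.1 (linearIndependent_of_triangular
      (v := fun i => ((1 : ℝ), v i)) (Fin.cons (LinearMap.fst ℝ ℝ _) fun i =>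
        (EuclideanSpace.proj i : EuclideanSpace ℝ (Fin 3) →L[ℝ] ℝ).toLinearMap ∘ₗ
          LinearMap.snd ℝ ℝ _) ?_ ?_) s w ?_
    · intro i
      fin_cases i
      · simp
      · exact ha.ne'
      · exact hc.ne'
      · exact hf.ne'
    · intro i j hij
      fin_cases i <;> fin_cases j <;> first | simp at hij; done | rfl
    · simp [Prod.ext_iff, Prod.fst_sum, Prod.snd_sum, hw, hw0]
  · change dist (v i) (v j) = _
    have h1 := hin i j
    rw [hG, vertexGram_of_ne _ _ h, gramFun] at h1
    rw [dist_eq_norm]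
    exact (sq_eq_sq₀ (norm_nonneg _) (le_of_lt (hx _))).1 (by linarith)

/-- Positivity at the single vertex 0 suffices: it yields a tetrahedron, and the other vertices
follow from that. -/
theorem exists_tetrahedron {g : Geometry} {x : Edge → ℝ} (hx : ∀ e, x e ∈ g.lengthRange)
    (hpos : g.TangentPos x 0 1 2 3) : ∃ T : Tetrahedron g, T.lengths = x := by
  have key : ∀ T : Tetrahedron g, (∀ {i j : Fin 4} (h : i ≠ j), T.length i j = x (edge h)) →
      T.lengths = x := by
    intro T h
    funext e
    rw [← edge_fst_snd e, T.lengths_edge, h]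
  cases g
  · obtain ⟨T, hT⟩ := exists_sphericalTetrahedron hx hpos
    exact ⟨T, key T hT⟩
  · obtain ⟨T, hT⟩ := exists_hyperbolicTetrahedron hx hpos
    exact ⟨T, key T hT⟩
  · obtain ⟨T, hT⟩ := exists_euclideanTetrahedron hx hpos
    exact ⟨T, key T hT⟩

theorem Geometry.continuous_tangentGram (g : Geometry) (i a b : Fin 4) :
    Continuous fun x : Edge → ℝ => g.tangentGram x i a b := by
  have h := fun c d => (g.differentiable_vertexGram c d).continuous
  cases g
  · exact (h a b).sub ((h a i).mul (h b i))
  · exact (h a b).add ((h a i).mul (h b i))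
  · exact ((h a b).sub (h a i)).sub (h b i)

theorem Geometry.isOpen_tangentPos (g : Geometry) (i j k l : Fin 4) :
    IsOpen {x : Edge → ℝ | g.TangentPos x i j k l} := by
  have h := fun a b => g.continuous_tangentGram i a b
  have hjj := h j j
  have hkk := h k k
  have hll := h l l
  have hjk := h j k
  have hjl := h j l
  have hkl := h k l
  simp only [TangentPos, PosMinors, Set.ofPred_and]
  refine (isOpen_lt continuous_const hjj).inter ((isOpen_lt continuous_const ?_).inter
    (isOpen_lt continuous_const ?_))
  · fun_prop
  · fun_prop

/-! ### The curvature map near the lengths of a tetrahedron -/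

namespace Tetrahedron

variable {g : Geometry} (T : Tetrahedron g)

theorem eventually_exists : ∀ᶠ x in 𝓝 T.lengths, ∃ T' : Tetrahedron g, T'.lengths = x := by
  have h1 : ∀ᶠ x in 𝓝 T.lengths, ∀ e, x e ∈ g.lengthRange :=
    Filter.eventually_all.2 fun e => (continuous_apply e).continuousAt.eventually
      (g.isOpen_lengthRange.mem_nhds (T.deriv_neg_and_mem_lengthRange e).2)
  have h2 : ∀ᶠ x in 𝓝 T.lengths, g.TangentPos x 0 1 2 3 :=
    (g.isOpen_tangentPos 0 1 2 3).mem_nhds (T.tangentPos (by decide))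
  filter_upwards [h1, h2] with x hx1 hx2 using exists_tetrahedron hx1 hx2

theorem angles_edge {i j k l : Fin 4} (hij : i ≠ j) (h : [i, j, k, l].Nodup) :
    T.angles (edge hij) = g.faceAngle T.lengths k l := by
  have hkl : k ≠ l := by simp at h; tauto
  rw [← edge_ends _ (g.faceAngle_comm T.lengths) hkl, ← opp_edge hij hkl h]
  refine T.dihedral_eq_faceAngle ?_
  have key : ∀ e : Edge, [e.fst, e.snd, e.opp.fst, e.opp.snd].Nodup := by decide
  exact key _

theorem angles_eq : T.angles =
    fun e => g.faceAngle T.lengths e.opp.fst e.opp.snd := by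
  funext e
  refine T.dihedral_eq_faceAngle ?_
  have key : ∀ e : Edge, [e.fst, e.snd, e.opp.fst, e.opp.snd].Nodup := by decide
  exact key _

/-- The angles depend on the lengths alone, so the tetrahedron chosen in the definition is
immaterial. -/
theorem curvatureMap_lengths : curvatureMap g T.lengths = T.angles := by
  have h : ∃ T' : Tetrahedron g, T'.lengths = T.lengths := ⟨T, rfl⟩
  rw [curvatureMap, dif_pos h, angles_eq, angles_eq, h.choose_spec]

theorem curvatureMap_eventuallyEq : curvatureMap g =ᶠ[𝓝 T.lengths]
    fun x e => g.faceAngle x e.opp.fst e.opp.snd := by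
  filter_upwards [T.eventually_exists] with x ⟨T', hT'⟩
  rw [← hT', curvatureMap_lengths, angles_eq]

theorem differentiableAt_curvatureMap : DifferentiableAt ℝ (curvatureMap g) T.lengths := by
  refine DifferentiableAt.congr_of_eventuallyEq ?_ T.curvatureMap_eventuallyEq
  exact differentiableAt_pi.2 fun e => T.admissible.differentiableAt_faceAngle e.opp.fst_ne_snd

theorem angleDeriv_lengths {i j k l : Fin 4} (hij : i ≠ j) (h : [i, j, k, l].Nodup) (f : Edge) :
    angleDeriv g T.lengths (edge hij) f =
      deriv (fun t => g.faceAngle (Function.update T.lengths f t) k l) (T.lengths f) := by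
  have hkl : k ≠ l := by simp at h; tauto
  refine Filter.EventuallyEq.deriv_eq ?_
  have hc : ContinuousAt (fun t => Function.update T.lengths f t) (T.lengths f) :=
    (continuous_const.update f continuous_id).continuousAt
  -- Restrict the local formula for the curvature map to the coordinate line through the lengths of
  -- T.
  have hev := hc.eventually (p := fun x => curvatureMap g x =
    fun e => g.faceAngle x e.opp.fst e.opp.snd)
    (by beta_reduce; rw [Function.update_eq_self]; exact T.curvatureMap_eventuallyEq)
  filter_upwards [hev] with t ht
  rw [ht]
  beta_reduce
  rw [opp_edge hij hkl h]
  exact edge_ends _ (g.faceAngle_comm _) hkl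

/-- The quantity `P` in terms of the face normals. -/
theorem angleP_lengths {i j k l p q r s : Fin 4} (hij : i ≠ j) (h : [i, j, k, l].Nodup)
    (hrs : r ≠ s) (h' : [r, s, p, q].Nodup) :
    angleP g T.lengths (edge hij) (edge hrs) = g.oppositeP T.lengths *
      ((g.faceCos T.lengths k r * g.faceCos T.lengths l s +
        g.faceCos T.lengths k s * g.faceCos T.lengths l r -
        g.faceCos T.lengths k l * (g.faceCos T.lengths k r * g.faceCos T.lengths k s +
          g.faceCos T.lengths l r * g.faceCos T.lengths l s)) /
        (1 - g.faceCos T.lengths k l ^ 2)) := by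
  have hkl : k ≠ l := by simp at h; tauto
  have hn : [p, q, r, s].Nodup := by simp at h' ⊢; tauto
  rw [angleP, T.curvatureMap_lengths, T.angles_edge hij h, T.angles_edge hrs h',
    T.angleDeriv_lengths hij h, T.admissible.deriv_faceAngle_div hkl hn hrs,
    T.admissible.sin_faceAngle_sq hkl]

theorem cos_angles_edge {i j k l : Fin 4} (hij : i ≠ j) (h : [i, j, k, l].Nodup) :
    Real.cos (T.angles (edge hij)) = -g.faceCos T.lengths k l := by
  have hkl : k ≠ l := by simp at h; tauto
  rw [T.angles_edge hij h, T.admissible.cos_faceAngle hkl]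

/-- For {r, s} = {k, l} the numerator is 1 + u_kl² - 2 u_kl² = sin² a_ij. -/
theorem angleP_opposite {i j k l : Fin 4} (hij : i ≠ j) (hkl : k ≠ l)
    (h : [i, j, k, l].Nodup) :
    angleP g T.lengths (edge hij) (edge hkl) = g.oppositeP T.lengths := by
  have h' : [k, l, i, j].Nodup := by simp at h ⊢; tauto
  have hne := (T.admissible.one_sub_faceCos_sq_pos hkl).ne'
  rw [T.angleP_lengths hij h hkl h', T.admissible.faceCos_self, T.admissible.faceCos_self,
    faceCos_comm g _ l k]
  field_simp
  ring

/-- For {r, s} = {i, k} the numerator is u_il (1 - u_kl²), and u_il = -cos a_jk. -/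
theorem angleP_adjacent {i j k l : Fin 4} (hij : i ≠ j) (hik : i ≠ k) (hjk : j ≠ k)
    (h : [i, j, k, l].Nodup) :
    angleP g T.lengths (edge hij) (edge hik) =
      -g.oppositeP T.lengths * Real.cos (T.angles (edge hjk)) := by
  have hkl : k ≠ l := by simp at h; tauto
  have h1 : [i, k, j, l].Nodup := by simp at h ⊢; tauto
  have h2 : [j, k, i, l].Nodup := by simp at h ⊢; tauto
  have hne := (T.admissible.one_sub_faceCos_sq_pos hkl).ne'
  rw [T.angleP_lengths hij h hik h1, T.admissible.faceCos_self, T.cos_angles_edge hjk h2,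
    faceCos_comm g _ l k, faceCos_comm g _ l i]
  field_simp
  ring

end Tetrahedron

/-! ### The identities -/

theorem theorem2p1 (g : Geometry) (T : Tetrahedron g) :
    -- the lengths and angles at an edge do not depend on how its endpoints are ordered
    ((∀ (i j k l : Fin 4) (hij : i ≠ j), i ≠ k → i ≠ l → j ≠ k → j ≠ l → k ≠ l →
        T.lengths (edge hij) = T.length i j ∧ T.angles (edge hij) = T.dihedral i j k l) ∧
      -- near `T` the angles are differentiable functions of the six lengths, with nonzero sines
      (∀ᶠ x in 𝓝 T.lengths, ∃ T' : Tetrahedron g, T'.lengths = x) ∧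
      (∀ T' : Tetrahedron g, curvatureMap g T'.lengths = T'.angles) ∧
      DifferentiableAt ℝ (curvatureMap g) T.lengths ∧
      (∀ e : Edge, Real.sin (T.angles e) ≠ 0)) ∧
    (let P : Edge → Edge → ℝ := angleP g T.lengths
     let c : Edge → ℝ := fun e => Real.cos (T.angles e)
     -- (i)
     (∀ e f : Edge, P e f = P f e) ∧
     (∀ (i j k l : Fin 4) (hij : i ≠ j) (hik : i ≠ k) (hil : i ≠ l)
        (hjk : j ≠ k) (hjl : j ≠ l) (hkl : k ≠ l),
        -- (ii)
        (P (edge hij) (edge hkl) = P (edge hik) (edge hjl) ∧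
          P (edge hik) (edge hjl) = P (edge hil) (edge hjk)) ∧
        -- (iii)
        P (edge hij) (edge hik) = -P (edge hij) (edge hkl) * c (edge hjk) ∧
        -- (iv)
        P (edge hij) (edge hij) = P (edge hij) (edge hkl) *
          ((c (edge hij) * c (edge hjk) * c (edge hik) +
              c (edge hij) * c (edge hjl) * c (edge hil) +
              c (edge hik) * c (edge hjl) + c (edge hil) * c (edge hjk)) /
            Real.sin (T.angles (edge hij)) ^ 2)) ∧
     -- (v)
     (∀ e f : Edge, e ≠ f → P e f = P e.opp f.opp)) := by
  refine ⟨⟨?_, T.eventually_exists, fun T' => T'.curvatureMap_lengths,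
    T.differentiableAt_curvatureMap, ?_⟩, ?_, ?_, ?_⟩
  · intro i j k l hij hik hil hjk hjl hkl
    have h : [i, j, k, l].Nodup := by simp; tauto
    exact ⟨T.lengths_edge hij, by rw [T.angles_edge hij h, T.dihedral_eq_faceAngle h]⟩
  · intro e
    rw [T.angles_eq]
    exact (T.admissible.sin_faceAngle_pos e.opp.fst_ne_snd).ne'
  · intro e f
    rcases e.trichotomy f with rfl | rfl | ⟨i, j, k, l, hij, hik, h, rfl, rfl⟩
    · rfl
    · obtain ⟨i, j, k, l, hij, h, rfl⟩ := e.exists_rep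
      have hkl : k ≠ l := by simp at h; tauto
      have h' : [k, l, i, j].Nodup := by simp at h ⊢; tauto
      rw [opp_edge hij hkl h, T.angleP_opposite hij hkl h, T.angleP_opposite hkl hij h']
    · have hjk : j ≠ k := by simp at h; tauto
      have h' : [i, k, j, l].Nodup := by simp at h ⊢; tauto
      rw [T.angleP_adjacent hij hik hjk h, T.angleP_adjacent hik hij hjk.symm h', edge_comm hjk]
  · intro i j k l hij hik hil hjk hjl hkl
    have h : [i, j, k, l].Nodup := by simp; tauto
    have hikjl : [i, k, j, l].Nodup := by simp at h ⊢; tauto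
    have hiljk : [i, l, j, k].Nodup := by simp at h ⊢; tauto
    have hjkil : [j, k, i, l].Nodup := by simp at h ⊢; tauto
    have hjlik : [j, l, i, k].Nodup := by simp at h ⊢; tauto
    refine ⟨⟨?_, ?_⟩, ?_, ?_⟩
    · rw [T.angleP_opposite hij hkl h, T.angleP_opposite hik hjl hikjl]
    · rw [T.angleP_opposite hik hjl hikjl, T.angleP_opposite hil hjk hiljk]
    · rw [T.angleP_opposite hij hkl h, T.angleP_adjacent hij hik hjk h]
    · have hklij : [k, l, i, j].Nodup := by simp at h ⊢; tauto
      -- With every cosine replaced by -u, the products of two keep their sign and those of three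
      -- change it; this is the numerator of the general formula.
      rw [T.angleP_opposite hij hkl h, T.angleP_lengths hij h hij h, Real.sin_sq]
      simp only [T.cos_angles_edge hij h, T.cos_angles_edge hjk hjkil,
        T.cos_angles_edge hik hikjl, T.cos_angles_edge hjl hjlik, T.cos_angles_edge hil hiljk,
        faceCos_comm g _ k i, faceCos_comm g _ k j, faceCos_comm g _ l i, faceCos_comm g _ l j]
      rw [neg_sq]
      congr 2
      ring
  · intro e f hef
    rcases e.trichotomy f with rfl | rfl | ⟨i, j, k, l, hij, hik, h, rfl, rfl⟩
    · exact absurd rfl hef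
    · obtain ⟨i, j, k, l, hij, h, rfl⟩ := e.exists_rep
      have hkl : k ≠ l := by simp at h; tauto
      have h' : [k, l, i, j].Nodup := by simp at h ⊢; tauto
      rw [opp_edge hij hkl h, opp_edge hkl hij h', T.angleP_opposite hij hkl h,
        T.angleP_opposite hkl hij h']
    · have hjk : j ≠ k := by simp at h; tauto
      have hlk : l ≠ k := by simp at h; tauto
      have hlj : l ≠ j := by simp at h; tauto
      have h1 : [i, j, l, k].Nodup := by simp at h ⊢; tauto
      have h2 : [i, k, l, j].Nodup := by simp at h ⊢; tauto
      have h3 : [l, k, j, i].Nodup := by simp at h ⊢; tauto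
      -- The complements of ij and ik are lk and lj. They meet at l, and the third side of their
      -- triangle is again jk, so the same cosine appears.
      rw [opp_edge hij hlk h1, opp_edge hik hlj h2, T.angleP_adjacent hij hik hjk h,
        T.angleP_adjacent hlk hlj hjk.symm h3, edge_comm hjk]
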